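/- Let $\Gamma$ be a countable group acting by Borel, nonsingular transformations on a standard probability space $(B,\nu)$, and suppose the action is essentially free (for a.e. $b$, $gb=b$ implies $g=e$). Let $c(g,b)=-\log\frac{d(\nu\circ g)}{d\nu}(b)=\log\frac{d(\nu\circ g^{-1})}{d\nu}(gb)$, where $(\nu\circ g)(E)=\nu(gE)$, taken as a Borel cocycle, so that $g(b,t)=(gb,t+c(g,b))$ defines an action of $\Gamma$ on $B\times\mathbb R$ preserving $d\nu\, e^t dt$ (the Maharam extension). Let $T>0$, $I=[0,T]$, $d\theta_I(t)=\frac{e^t}{e^T-1}\,dt$, and let $\mathcal R_I$ be the restriction to $B\times I$ of the orbit relation on $B\times\mathbb R$. Write $m=\nu\times\theta_I$. Let $\mathbb I$ be $\{1,2,3,\dots\}$ or $\mathbb R_{>0}$, and let $\mathcal F=\{\mathcal F_r\}_{r\in\mathbb I}$ be a Borel family of subset functions for $\mathcal R_I$: $\mathcal F_r(y)$ is contained in the $\mathcal R_I$-class of $y$, $\bigcup_{s\le r}\mathcal F_s(y)$ is finite for all $y$ and $r$, and $\{(y,y',r): y'\in\mathcal F_r(y)\}$ is Borel. Put $\mathcal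 F_s^{-1}(y)=\{z: y\in\mathcal F_s(z)\}$ and $\mathcal F_s^{-1}\mathcal F_r(y)=\{z:\mathcal F_s(z)\cap\mathcal F_r(y)\neq\emptyset\}$. Assume that $\mathcal F$ is either (a) regular: for some $C_{reg}>0$, for $m$-a.e. $y$ and all $r$, $|\bigcup_{s\le r}\mathcal F_s^{-1}\mathcal F_r(y)|\le C_{reg}|\mathcal F_r(y)|$; or (b) asymptotically invariant, uniform and tempered, that is: for a.e. $y$ all $\mathcal F_r(y)$ are nonempty, and there is a countable set $\Psi$ of Borel automorphisms $\phi$ of $B\times I$ with graph in $\mathcal R_I$, such that for a.e. $y$ every point of the class of $y$ is the image of $y$ under an element of the group generated by $\Psi$, and for every $\phi\in\Psi$, $|\mathcal F_r(y)\,\triangle\,\phi(\mathcal F_r(y))|/|\mathcal F_r(y)|\to0$ as $r\to\infty$ for a.e. $y$; there are constants $C_u,a_r,b_r>0$ with $b_r\le C_ua_r$ such that for each $r$ both $|\mathcal F_r(y)|$ and $|\mathcal F_r^{-1}(y)|$ lie in $[a_r,b_r]$ for a.e. $y$; and $\mathbb I=\{1,2,\dots\}$ and for some $C_t>0$, for a.e.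 $y$ and all $n$, $|\bigcup_{m<n}\mathcal F_m^{-1}\mathcal F_n(y)|\le C_t|\mathcal F_n(y)|$. For a probability-measure-preserving Borel action of $\Gamma$ on a standard probability space $(X,\mu)$, let $\Gamma$ act on $B\times X\times\mathbb R$ by $g(b,x,t)=(gb,gx,t+c(g,b))$, let $[b,x,t]$ be the class of $(b,x,t)$ for the orbit relation restricted to $B\times X\times I$, let $\pi(b,x,t)=(b,t)$, and set $\tilde{\mathcal F}_r(b,x,t)=\pi^{-1}(\mathcal F_r(b,t))\cap[b,x,t]$. Let $\mathbb A[h|\tilde{\mathcal F}_r](p)=|\tilde{\mathcal F}_r(p)|^{-1}\sum_{q\in\tilde{\mathcal F}_r(p)}h(q)$ ($0$ if $\tilde{\mathcal F}_r(p)=\emptyset$). For $f\in L^1(B\times X\times I,\nu\times\mu\times\theta_I)$ and $\psi\in L^1(B,\nu)$ with $\psi\ge0$ put $$\mathbb M[f|\tilde{\mathcal F}](b,x,t)=\sup_{r\in\mathbb I}\mathbb A[|f|\,|\tilde{\mathcal F}_r](b,x,t),\qquad \overline{\mathbb M}[f|\tilde{\mathcal F}](b,x)=\sup_{r\in\mathbb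 I}\frac1T\int_0^T\mathbb A[|f|\,|\tilde{\mathcal F}_r](b,x,t)\,dt,$$ $$\mathbb M[f|\tilde{\mathcal F},\psi](x)=\sup_{r\in\mathbb I}\frac1T\int_B\int_0^T\mathbb A[|f|\,|\tilde{\mathcal F}_r](b,x,t)\,\psi(b)\,dt\,d\nu(b).$$ Let $\|f\|_{L\log L}=\inf\{k>0:\int\frac{|f|}{k}\log^+\frac{|f|}{k}\le1\}$, where $f\in L\log L$ means that $f$ is measurable and $\int|f|\log^+|f|<\infty$. Then there are constants $C_p>0$ ($1\le p\le\infty$), depending on neither $f$, $\psi$ nor the action $\Gamma\curvearrowright(X,\mu)$, such that for every such $(X,\mu)$ the three maximal functions are measurable with respect to the completed measures, and: (1) for $1<p\le\infty$ and $f\in L^p(B\times X\times I)$, $$\|\mathbb M[f|\tilde{\mathcal F}]\|_p\le C_p\|f\|_p,\qquad \|\overline{\mathbb M}[f|\tilde{\mathcal F}]\|_p\le C_p\Big(\frac{e^T-1}T\Big)^{1/p}\|f\|_p,$$ and if $\frac1p+\frac1q=1$ and $0\le\psi\in L^q(B)$, then $\|\mathbb M[f|\tilde{\mathcal F},\psi]\|_p\le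 C_p\big(\frac{e^T-1}T\big)^{1/p}\|\psi\|_q\|f\|_p$; (2) for $f\in L\log L(B\times X\times I)$, $$\|\mathbb M[f|\tilde{\mathcal F}]\|_1\le C_1\|f\|_{L\log L},\qquad \|\overline{\mathbb M}[f|\tilde{\mathcal F}]\|_1\le C_1\frac{e^T-1}T\|f\|_{L\log L},$$ and if $0\le\psi\in L^\infty(B)$, then $\|\mathbb M[f|\tilde{\mathcal F},\psi]\|_1\le C_1\frac{e^T-1}T\|\psi\|_\infty\|f\|_{L\log L}$. -/

import Mathlib

open MeasureTheory Filter Topology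
open scoped ENNReal NNReal symmDiff

namespace MaximalErgodic

/-! ### Subset functions of an equivalence relation -/

section SubsetFunctions

variable {Y : Type*}

/-- The inverse of a subset function: `U⁻¹(y) = {x | y ∈ U(x)}`. -/
def subsetInv (U : Y → Set Y) : Y → Set Y := fun y => {x | y ∈ U x}

/-- The product of subset functions: `(U V)(x) = ⋃_{y ∈ V(x)} U(y)`. -/
def subsetMul (U V : Y → Set Y) : Y → Set Y := fun x => ⋃ y ∈ V x, U y

/-- Cardinality of a set, as an extended nonnegative real (`∞` for infinite sets). -/
noncomputable def setCard (S : Set Y) : ℝ≥0∞ := (S.encard : ℝ≥0∞)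

/-- The average of a nonnegative function `g` over `U(x)`; it is `0` when `U(x)` is empty. -/
noncomputable def subsetAverage (g : Y → ℝ≥0∞) (U : Y → Set Y) (x : Y) : ℝ≥0∞ :=
  (∑' y : U x, g y) / setCard (U x)

/-- The index set of positive integers, as a subset of `ℝ`. -/
def posInt : Set ℝ := {r | ∃ n : ℕ, 0 < n ∧ (n : ℝ) = r}

/-- A Borel family of subset functions for `R` indexed by `𝕀 ⊆ ℝ`; as always in this context,
`⋃_{s ≤ r} F_s(x)` is required to be finite for all `x` and `r`. -/
structure IsBorelFamily [MeasurableSpace Y] (R : Y → Y → Prop) {𝕀 : Set ℝ}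
    (F : 𝕀 → Y → Set Y) : Prop where
  subset_class : ∀ r x, F r x ⊆ {y | R x y}
  measurable_graph : MeasurableSet {p : Y × Y × 𝕀 | p.2.1 ∈ F p.2.2 p.1}
  finite : ∀ r x, (⋃ s ≤ r, F s x).Finite

/-- Inner automorphisms of `R` (the full group): Borel automorphisms with graph inside `R`. -/
def IsInner [MeasurableSpace Y] (R : Y → Y → Prop) (φ : Equiv.Perm Y) : Prop :=
  Measurable φ ∧ Measurable φ.symm ∧ ∀ x, R x (φ x)

/-- `Ψ` generates `R`: for almost every `x`, every `y` in the class of `x` is `φ(x)` for some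
`φ` in the group generated by `Ψ`. -/
def Generates [MeasurableSpace Y] (R : Y → Y → Prop) (m : Measure Y)
    (Ψ : Set (Equiv.Perm Y)) : Prop :=
  ∀ᵐ x ∂m, ∀ y, R x y → ∃ φ ∈ Subgroup.closure Ψ, φ x = y

/-- Asymptotic invariance. -/
def IsAsymptoticallyInvariant [MeasurableSpace Y] (R : Y → Y → Prop) (m : Measure Y)
    {𝕀 : Set ℝ} (F : 𝕀 → Y → Set Y) : Prop :=
  (∀ᵐ x ∂m, ∀ r, (F r x).Nonempty) ∧
  ∃ Ψ : Set (Equiv.Perm Y), Ψ.Countable ∧ (∀ φ ∈ Ψ, IsInner R φ) ∧ Generates R m Ψ ∧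
    ∀ φ ∈ Ψ, ∀ᵐ x ∂m,
      Tendsto (fun r => setCard (F r x ∆ (φ '' F r x)) / setCard (F r x)) atTop (𝓝 0)

/-- Uniformity: the sizes of `F_r(x)` and `F_r⁻¹(x)` lie between `a_r` and `b_r ≤ C a_r`. -/
def IsUniformFamily [MeasurableSpace Y] (m : Measure Y) {𝕀 : Set ℝ} (F : 𝕀 → Y → Set Y) : Prop :=
  ∃ (C : ℝ≥0) (a b : 𝕀 → ℝ≥0), 0 < C ∧ (∀ r, 0 < a r) ∧ (∀ r, 0 < b r) ∧
    (∀ r, b r ≤ C * a r) ∧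
    (∀ r, ∀ᵐ x ∂m, (a r : ℝ≥0∞) ≤ setCard (F r x) ∧ setCard (F r x) ≤ b r) ∧
    (∀ r, ∀ᵐ x ∂m, (a r : ℝ≥0∞) ≤ setCard (subsetInv (F r) x) ∧ setCard (subsetInv (F r) x) ≤ b r)

/-- Regularity: `|⋃_{t ≤ r} F_t⁻¹ F_r (x)| ≤ C |F_r(x)|`. -/
def IsRegularFamily [MeasurableSpace Y] (m : Measure Y) {𝕀 : Set ℝ} (F : 𝕀 → Y → Set Y) : Prop :=
  ∃ C : ℝ≥0, 0 < C ∧ ∀ᵐ x ∂m, ∀ r,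
    setCard (⋃ t ≤ r, subsetMul (subsetInv (F t)) (F r) x) ≤ C * setCard (F r x)

/-- Temperedness (for sequences): `|⋃_{t < r} F_t⁻¹ F_r (x)| ≤ C |F_r(x)|`. -/
def IsTemperedFamily [MeasurableSpace Y] (m : Measure Y) {𝕀 : Set ℝ} (F : 𝕀 → Y → Set Y) : Prop :=
  𝕀 = posInt ∧ ∃ C : ℝ≥0, 0 < C ∧ ∀ᵐ x ∂m, ∀ r,
    setCard (⋃ t < r, subsetMul (subsetInv (F t)) (F r) x) ≤ C * setCard (F r x)

end SubsetFunctions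

/-! ### The space `L log L` -/

section LLogL

variable {Y : Type*} [MeasurableSpace Y]

/-- The Luxemburg norm of `L log L`, for the Young function `s ↦ s log⁺ s`. -/
noncomputable def lLogLNorm (f : Y → ℝ) (m : Measure Y) : ℝ≥0∞ :=
  ⨅ (k : ℝ≥0) (_ : 0 < k)
    (_ : ∫⁻ y, ENNReal.ofReal (|f y| / k * Real.posLog (|f y| / k)) ∂m ≤ 1), (k : ℝ≥0∞)

/-- Membership in `L log L` of a finite measure space: `∫ |f| log⁺ |f| < ∞`. -/
def MemLLogL (f : Y → ℝ) (m : Measure Y) : Prop :=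
  AEStronglyMeasurable f m ∧ ∫⁻ y, ENNReal.ofReal (|f y| * Real.posLog |f y|) ∂m < ∞

end LLogL

/-! ### The Radon-Nikodym cocycle and the Maharam extension -/

section Maharam

variable {Γ B : Type*} [Group Γ] [MulAction Γ B] [MeasurableSpace B]

/-- The logarithmic Radon-Nikodym derivative `-log (d(ν ∘ g)/dν)(b)`, where `(ν ∘ g)(E) = ν(gE)`,
i.e. `ν ∘ g` is the image of `ν` under `g⁻¹`. Equivalently (a.e.) it is
`log (d(ν ∘ g⁻¹)/dν)(g b)`. It is only defined up to null sets. -/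
noncomputable def logRN (ν : Measure B) (g : Γ) (b : B) : ℝ :=
  -Real.log ((ν.map (fun x => g⁻¹ • x)).rnDeriv ν b).toReal

/-- The `Γ`-invariant set of points on whose orbit the cocycle identity holds strictly. -/
def cocycleSet (Γ : Type*) {B : Type*} [Group Γ] [MulAction Γ B] [MeasurableSpace B]
    (ν : Measure B) : Set B :=
  {b | ∀ g h k : Γ, logRN ν (g * h) (k • b) = logRN ν g (h • k • b) + logRN ν h (k • b)}

open Classical in
/-- The logarithmic Radon-Nikodym cocycle: a version of `logRN` that satisfies the cocycle
identity everywhere. -/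
noncomputable def rnCocycle (ν : Measure B) (g : Γ) (b : B) : ℝ :=
  if b ∈ cocycleSet Γ ν then logRN ν g b else 0

theorem smul_mem_cocycleSet_iff (ν : Measure B) (k : Γ) (b : B) :
    k • b ∈ cocycleSet Γ ν ↔ b ∈ cocycleSet Γ ν := by
  constructor
  · intro hb g h l
    have := hb g h (l * k⁻¹)
    simpa [smul_smul, mul_assoc] using this
  · intro hb g h l
    have := hb g h (l * k)
    simpa [smul_smul, mul_assoc] using this

theorem rnCocycle_mul (ν : Measure B) (g h : Γ) (b : B) :
    rnCocycle ν (g * h) b = rnCocycle ν g (h • b) + rnCocycle ν h b := by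
  by_cases hb : b ∈ cocycleSet Γ ν
  · have h2 : h • b ∈ cocycleSet Γ ν := (smul_mem_cocycleSet_iff ν h b).2 hb
    have := hb g h 1
    simp only [rnCocycle, if_pos hb, if_pos h2]
    simpa using this
  · have h2 : h • b ∉ cocycleSet Γ ν := fun h' => hb ((smul_mem_cocycleSet_iff ν h b).1 h')
    simp only [rnCocycle, if_neg hb, if_neg h2, add_zero]

theorem logRN_mul [MeasurableConstSMul Γ B] (ν : Measure B) [IsProbabilityMeasure ν]
    (hns : ∀ g : Γ, Measure.QuasiMeasurePreserving (fun b : B => g • b) ν ν) (g h : Γ) :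
    ∀ᵐ b ∂ν, logRN ν (g * h) b = logRN ν g (h • b) + logRN ν h b := by
  have hm : ∀ k : Γ, Measurable (fun b : B => k • b) := fun k => measurable_const_smul k
  have hac : ∀ k : Γ, ν.map (fun b : B => k • b) ≪ ν := fun k => (hns k).absolutelyContinuous
  have hac' : ∀ k : Γ, ν ≪ ν.map (fun b : B => k • b) := by
    intro k
    have h1 := (hac k⁻¹).map (hm k)
    rw [Measure.map_map (hm k) (hm k⁻¹)] at h1
    have : (fun b : B => k • b) ∘ (fun b : B => k⁻¹ • b) = id := by
      funext b; simp
    rwa [this, Measure.map_id] at h1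
  have hmm : ν.map (fun b : B => (g * h)⁻¹ • b)
      = (ν.map (fun b : B => g⁻¹ • b)).map (fun b : B => h⁻¹ • b) := by
    rw [Measure.map_map (hm _) (hm _)]
    congr 1
    funext b
    simp [smul_smul]
  have : ∀ k : Γ, IsProbabilityMeasure (ν.map (fun b : B => k • b)) := fun k =>
    Measure.isProbabilityMeasure_map (hm k).aemeasurable
  have hemb : MeasurableEmbedding (fun b : B => h⁻¹ • b) := measurableEmbedding_const_smul h⁻¹
  have e1 := hemb.rnDeriv_map (ν.map (fun b : B => g⁻¹ • b)) ν
  have e1' : ∀ᵐ b ∂ν, ((ν.map (fun b : B => g⁻¹ • b)).map (fun b : B => h⁻¹ • b)).rnDeriv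
      (ν.map (fun b : B => h⁻¹ • b)) b = (ν.map (fun b : B => g⁻¹ • b)).rnDeriv ν (h • b) := by
    filter_upwards [(hns h).ae e1] with b hb
    simpa using hb
  have hacg : (ν.map (fun b : B => g⁻¹ • b)).map (fun b : B => h⁻¹ • b)
      ≪ ν.map (fun b : B => h⁻¹ • b) := (hac g⁻¹).map (hm _)
  have e2 := Measure.rnDeriv_mul_rnDeriv (κ := ν) hacg
  have fin : ∀ k : Γ, ∀ᵐ b ∂ν, ((ν.map (fun b : B => k • b)).rnDeriv ν b).toReal ≠ 0 := by
    intro k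
    filter_upwards [Measure.rnDeriv_pos' (hac' k), Measure.rnDeriv_lt_top
      (ν.map (fun b : B => k • b)) ν] with b h1 h2
    exact (ENNReal.toReal_pos h1.ne' h2.ne).ne'
  filter_upwards [e1', e2, (hns h).ae (fin g⁻¹), fin h⁻¹] with b h1 h2 h3 h4
  simp only [logRN]
  rw [hmm, ← h2, Pi.mul_apply, h1, ENNReal.toReal_mul, Real.log_mul h3 h4]
  ring

/-- The strict cocycle is a version of the logarithmic Radon-Nikodym derivative. -/
theorem rnCocycle_ae_eq [Countable Γ] [MeasurableConstSMul Γ B] (ν : Measure B)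
    [IsProbabilityMeasure ν]
    (hns : ∀ g : Γ, Measure.QuasiMeasurePreserving (fun b : B => g • b) ν ν) :
    ∀ᵐ b ∂ν, ∀ g : Γ, rnCocycle ν g b = logRN ν g b := by
  have : ∀ᵐ b ∂ν, b ∈ cocycleSet Γ ν := by
    refine ae_all_iff.2 fun g => ae_all_iff.2 fun h => ae_all_iff.2 fun k => ?_
    exact (hns k).ae (logRN_mul ν hns g h)
  filter_upwards [this] with b hb g
  simp [rnCocycle, hb]

/-- The Maharam extension of `Γ ↷ (B, ν)`: the action on `B × ℝ` given by
`g (b, t) = (g b, t + c(g, b))`, which preserves `ν × e^t dt`. -/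
noncomputable def maharam (ν : Measure B) (g : Γ) (p : B × ℝ) : B × ℝ :=
  (g • p.1, p.2 + rnCocycle ν g p.1)

variable (Γ) in
/-- The orbit relation of the Maharam extension restricted to `B × [0,T]`. -/
def relI (ν : Measure B) (T : ℝ) (p q : B × Set.Icc (0 : ℝ) T) : Prop :=
  ∃ g : Γ, maharam ν g (p.1, (p.2 : ℝ)) = (q.1, (q.2 : ℝ))

variable (Γ) in
/-- The orbit relation, restricted to `B × X × [0,T]`, of the action
`g (b, x, t) = (g b, g x, t + c(g, b))` on `B × X × ℝ`. -/
def relIX (ν : Measure B) (T : ℝ) {X : Type*} [MulAction Γ X]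
    (p q : B × X × Set.Icc (0 : ℝ) T) : Prop :=
  ∃ g : Γ, maharam ν g (p.1, (p.2.2 : ℝ)) = (q.1, (q.2.2 : ℝ)) ∧ g • p.2.1 = q.2.1

/-- Lebesgue measure on `[0,T]`. -/
noncomputable def lebI (T : ℝ) : Measure (Set.Icc (0 : ℝ) T) :=
  (volume : Measure ℝ).comap Subtype.val

/-- The probability measure `e^t / (e^T - 1) dt` on `[0,T]`. -/
noncomputable def thetaI (T : ℝ) : Measure (Set.Icc (0 : ℝ) T) :=
  (lebI T).withDensity fun t => ENNReal.ofReal (Real.exp t / (Real.exp T - 1))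

variable (Γ) in
/-- The lift of a subset function from `B × [0,T]` to `B × X × [0,T]`: the preimage of `U(b,t)`
under the projection, intersected with the class of `(b,x,t)`. -/
def liftSubset (ν : Measure B) {T : ℝ} {X : Type*} [MulAction Γ X]
    (U : B × Set.Icc (0 : ℝ) T → Set (B × Set.Icc (0 : ℝ) T))
    (p : B × X × Set.Icc (0 : ℝ) T) : Set (B × X × Set.Icc (0 : ℝ) T) :=
  {q | (q.1, q.2.2) ∈ U (p.1, p.2.2)} ∩ {q | relIX Γ ν T p q}

/-! ### The maximal operators -/

variable {T : ℝ} {X : Type*} [MulAction Γ X] {𝕀 : Set ℝ}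

variable (Γ) in
/-- The pointwise maximal operator `M[f | F̃](b,x,t) = sup_r A[|f| | F̃_r](b,x,t)`. -/
noncomputable def maxOp (ν : Measure B)
    (F : 𝕀 → B × Set.Icc (0 : ℝ) T → Set (B × Set.Icc (0 : ℝ) T))
    (f : B × X × Set.Icc (0 : ℝ) T → ℝ) (p : B × X × Set.Icc (0 : ℝ) T) : ℝ≥0∞ :=
  ⨆ r : 𝕀, subsetAverage (fun q => ‖f q‖ₑ) (liftSubset Γ ν (F r)) p

variable (Γ) in
/-- The maximal operator of the `t`-averages: `sup_r (1/T) ∫_0^T A[|f| | F̃_r](b,x,t) dt`. -/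
noncomputable def maxOpBar (ν : Measure B)
    (F : 𝕀 → B × Set.Icc (0 : ℝ) T → Set (B × Set.Icc (0 : ℝ) T))
    (f : B × X × Set.Icc (0 : ℝ) T → ℝ) (p : B × X) : ℝ≥0∞ :=
  ⨆ r : 𝕀, ENNReal.ofReal (1 / T) *
    ∫⁻ t, subsetAverage (fun q => ‖f q‖ₑ) (liftSubset Γ ν (F r)) (p.1, p.2, t) ∂(lebI T)

variable (Γ) in
/-- The weighted maximal operator
`sup_r (1/T) ∫ ∫_0^T A[|f| | F̃_r](b,x,t) ψ(b) dt dν(b)`, for `ψ ≥ 0`. -/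
noncomputable def maxOpWeighted (ν : Measure B)
    (F : 𝕀 → B × Set.Icc (0 : ℝ) T → Set (B × Set.Icc (0 : ℝ) T))
    (f : B × X × Set.Icc (0 : ℝ) T → ℝ) (ψ : B → ℝ) (x : X) : ℝ≥0∞ :=
  ⨆ r : 𝕀, ENNReal.ofReal (1 / T) *
    ∫⁻ b, ∫⁻ t,
      subsetAverage (fun q => ‖f q‖ₑ) (liftSubset Γ ν (F r)) (b, x, t) * ENNReal.ofReal (ψ b) ∂(lebI T) ∂ν

end Maharam

end MaximalErgodic

open MaximalErgodic

/-! The maximal operator is linearized. On a set E an index r(p) is chosen measurably so that the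
average of f over F_{r(p)}(p) exceeds a prescribed height; put U(p) = F_{r(p)}(p) on E and U(p) = ∅
elsewhere. The orbit relation preserves the measure, so by mass transport the integral of the
averages over U(p) equals ∫ f N, where N(q) is the sum of 1/|U(p)| over all p with q ∈ U(p).
Everything reduces to integrability of N, uniformly in E and r.

The core is the moment bound ∫ N^(k+1) ≤ (k+1)! C^k m(E)
(`OrbitChart.lintegral_totalPacking_pow_le`). Expanding a power of N along the term of largest rank
r(p) (`tsum_pow_succ_le`) and transporting back leaves averages over U(p) of powers of the packing
function of the sets of lower rank. Regularity bounds the number of lower sets that meet U(p); in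
the other case temperedness does so for strictly lower ranks and uniformity handles equal ranks.
Induction on k (`tsum_packing_pow_le`) then gives the bound without selecting any disjoint
subfamily.

Factorial growth of the moments amounts to exponential integrability of N. Against this, Young's
inequality for a log⁺ a and exp b gives the L log L bound
(`IsMaximalFamily.lintegral_le_of_posLog`). A single moment of order n+1 gives a weak-type bound of
exponent 1 + 1/n (`IsMaximalFamily.measure_one_lt_le`), and Marcinkiewicz interpolation with L^∞
reaches every p > 1 + 1/n.

The constant does not see X: by essential freeness the projection to B × [0,T] is injective on
almost every class, so lifted sets have the cardinalities of the original ones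
(`setCard_liftSubset`). The averaged maximal functions are controlled by the pointwise one through
dt ≤ (e^T - 1) dθ_I, Jensen and Hölder. As the index set may be uncountable, suprema and the choice
of r are handled by a measurable section theorem (`exists_measurable_section`). -/

namespace MaximalErgodic

/-! ### Measurable sections and suprema over uncountable families -/

section Selection

/-- The sequences whose first terms are the given list, in reverse order. -/
def listCylinder : List ℕ → Set (ℕ → ℕ)
  | [] => Set.univ
  | j :: l => {z | z ∈ listCylinder l ∧ z l.length = j}

open Classical in
/-- Greedy branch through a tree of sets: extend by the least digit that keeps `y` inside. -/
noncomputable def nextDigit {Y : Type*} (H : List ℕ → Set Y) (l : List ℕ) (y : Y) : ℕ :=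
  if h : ∃ j, y ∈ H (j :: l) then Nat.find h else 0

/-- The prefixes of the greedy branch. -/
noncomputable def branchPrefix {Y : Type*} (H : List ℕ → Set Y) : ℕ → Y → List ℕ
  | 0, _ => []
  | k + 1, y => nextDigit H (branchPrefix H k y) y :: branchPrefix H k y

theorem length_branchPrefix {Y : Type*} (H : List ℕ → Set Y) (k : ℕ) (y : Y) :
    (branchPrefix H k y).length = k := by
  induction k with
  | zero => rfl
  | succ k ih => simp [branchPrefix, ih]

theorem mem_listCylinder_branchPrefix {Y : Type*} (H : List ℕ → Set Y) (k : ℕ) (y : Y)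
    (w : ℕ → ℕ) :
    w ∈ listCylinder (branchPrefix H k y) ↔
      ∀ i < k, w i = nextDigit H (branchPrefix H i y) y := by
  induction k with
  | zero => simp [branchPrefix, listCylinder]
  | succ k ih =>
    simp only [branchPrefix, listCylinder, Set.mem_ofPred_eq, ih, length_branchPrefix]
    constructor
    · rintro ⟨h1, h2⟩ i hi
      rcases Nat.lt_succ_iff_lt_or_eq.1 hi with h | rfl
      · exact h1 i h
      · exact h2
    · intro h
      exact ⟨fun i hi => h i (by omega), h k (by omega)⟩

theorem nextDigit_mem {Y : Type*} {H : List ℕ → Set Y} {l : List ℕ} {y : Y}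
    (h : ∃ j, y ∈ H (j :: l)) : y ∈ H (nextDigit H l y :: l) := by
  classical
  rw [nextDigit, dif_pos h]
  exact Nat.find_spec h

open Classical in
theorem measurable_nextDigit {Y : Type*} [MeasurableSpace Y] {H : List ℕ → Set Y}
    (hH : ∀ l, MeasurableSet (H l)) (l : List ℕ) : Measurable (nextDigit H l) := by
  refine measurable_to_countable' fun j => ?_
  -- The digit defaults to 0 when no child contains y; the second piece accounts for this.
  have : nextDigit H l ⁻¹' {j} =
      ({y | y ∈ H (j :: l)} ∩ ⋂ i, ⋂ (_ : i < j), {y | y ∈ H (i :: l)}ᶜ) ∪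
        ({y | j = 0} ∩ ⋂ i, {y | y ∈ H (i :: l)}ᶜ) := by
    ext y
    simp only [Set.mem_preimage, Set.mem_singleton_iff, nextDigit]
    split_ifs with h
    · rw [Nat.find_eq_iff]
      obtain ⟨i, hi⟩ := h
      simp only [Set.mem_union, Set.mem_inter_iff, Set.mem_ofPred_eq, Set.mem_iInter,
        Set.mem_compl_iff]
      constructor
      · exact fun h => Or.inl h
      · rintro (h | h)
        · exact h
        · exact absurd hi (h.2 i)
    · push Not at h
      simp [h, eq_comm]
  rw [this]
  refine ((hH _).inter (MeasurableSet.iInter fun i => MeasurableSet.iInter fun _ =>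
    (hH _).compl)).union ((MeasurableSet.const _).inter (MeasurableSet.iInter fun i =>
    (hH _).compl))

theorem measurableSet_branchPrefix_eq {Y : Type*} [MeasurableSpace Y] {H : List ℕ → Set Y}
    (hH : ∀ l, MeasurableSet (H l)) (k : ℕ) (l : List ℕ) :
    MeasurableSet {y | branchPrefix H k y = l} := by
  induction k generalizing l with
  | zero => exact MeasurableSet.const ([] = l)
  | succ k ih =>
    cases l with
    | nil => simp [branchPrefix]
    | cons j l =>
      have : {y | branchPrefix H (k + 1) y = j :: l} =
          {y | branchPrefix H k y = l} ∩ nextDigit H l ⁻¹' {j} := by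
        ext y
        simp only [branchPrefix, List.cons.injEq, Set.mem_ofPred_eq, Set.mem_inter_iff,
          Set.mem_preimage, Set.mem_singleton_iff]
        constructor
        · rintro ⟨h1, h2⟩
          exact ⟨h2, h2 ▸ h1⟩
        · rintro ⟨h1, h2⟩
          exact ⟨h1 ▸ h2, h1⟩
      rw [this]
      exact (ih l).inter (measurable_nextDigit hH l (measurableSet_singleton j))

theorem measurable_branch {Y : Type*} [MeasurableSpace Y] {H : List ℕ → Set Y}
    (hH : ∀ l, MeasurableSet (H l)) :
    Measurable fun (y : Y) (k : ℕ) => nextDigit H (branchPrefix H k y) y := by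
  refine measurable_pi_lambda _ fun k => measurable_to_countable' fun j => ?_
  have : (fun y => nextDigit H (branchPrefix H k y) y) ⁻¹' {j} =
      ⋃ l : List ℕ, {y | branchPrefix H k y = l} ∩ nextDigit H l ⁻¹' {j} := by
    ext y
    simp
  rw [this]
  exact MeasurableSet.iUnion fun l => (measurableSet_branchPrefix_eq hH k l).inter
    (measurable_nextDigit hH l (measurableSet_singleton j))

/-- **Measurable sections**: a Borel subset of a product of standard Borel spaces has a section
which is Borel and defined almost everywhere on its projection. -/
theorem exists_measurable_section {Y S : Type*} [MeasurableSpace Y] [StandardBorelSpace Y]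
    [MeasurableSpace S] [StandardBorelSpace S] [Nonempty S] (m : Measure Y) [IsFiniteMeasure m]
    {A : Set (Y × S)} (hA : MeasurableSet A) :
    ∃ (D : Set Y) (r : Y → S), MeasurableSet D ∧ Measurable r ∧ (∀ y ∈ D, (y, r y) ∈ A) ∧
      ∀ᵐ y ∂m, ∀ s, (y, s) ∈ A → y ∈ D := by
  let := upgradeStandardBorel Y
  let := upgradeStandardBorel S
  have hA' := hA.analyticSet
  rw [AnalyticSet] at hA'
  rcases hA' with rfl | ⟨f, hf, rfl⟩
  · exact ⟨∅, fun _ => Classical.arbitrary S, MeasurableSet.empty, measurable_const,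
      by simp, by simp⟩
  let W : List ℕ → Set Y := fun l => (fun z => (f z).1) '' listCylinder l
  -- `W l` is only analytic, so it is enlarged to a Borel set. The measurable hull ensures that only
  -- a null set is lost from a node to its children; the closure forces a branch whose nodes all
  -- contain y to have image y.
  let H : List ℕ → Set Y := fun l => toMeasurable m (W l) ∩ closure (W l)
  have hH : ∀ l, MeasurableSet (H l) := fun l =>
    (measurableSet_toMeasurable m _).inter isClosed_closure.measurableSet
  have hWH : ∀ l, W l ⊆ H l := fun l => Set.subset_inter (subset_toMeasurable m _) subset_closure
  have hWu : ∀ l, W l ⊆ ⋃ j, W (j :: l) := by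
    rintro l y ⟨z, hz, rfl⟩
    exact Set.mem_iUnion.2 ⟨z l.length, z, ⟨hz, rfl⟩, rfl⟩
  let N : Set Y := ⋃ l, H l \ ⋃ j, H (j :: l)
  have hNm : MeasurableSet N :=
    MeasurableSet.iUnion fun l => (hH l).diff (MeasurableSet.iUnion fun j => hH _)
  have hN : m N = 0 := by
    refine measure_iUnion_null fun l => ?_
    -- The children form a Borel cover of `W l`, and the hull of `W l` exceeds any such cover by a
    -- null set only.
    have hsub : W l ⊆ ⋃ j, H (j :: l) :=
      (hWu l).trans (Set.iUnion_mono fun j => hWH _)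
    have hM : MeasurableSet (⋃ j, H (j :: l)) := MeasurableSet.iUnion fun j => hH _
    refine measure_mono_null (Set.sdiff_subset_sdiff_left Set.inter_subset_left) ?_
    have h1 := measure_inter_add_sdiff (μ := m) (toMeasurable m (W l)) hM
    rw [measure_toMeasurable] at h1
    have h2 : m (W l) ≤ m (toMeasurable m (W l) ∩ ⋃ j, H (j :: l)) :=
      measure_mono (Set.subset_inter (subset_toMeasurable m _) hsub)
    by_contra h3
    exact absurd h1 (((ENNReal.lt_add_right (measure_ne_top m _) h3).trans_le'  h2).ne')
  let z : Y → ℕ → ℕ := fun y k => nextDigit H (branchPrefix H k y) y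
  have hz : Measurable z := measurable_branch hH
  have key : ∀ y ∈ H [] \ N, (f (z y)).1 = y := by
    rintro y ⟨hy0, hyN⟩
    have hmem : ∀ k, y ∈ H (branchPrefix H k y) := by
      intro k
      induction k with
      | zero => exact hy0
      | succ k ih =>
        have : ∃ j, y ∈ H (j :: branchPrefix H k y) := by
          by_contra hcon
          refine hyN (Set.mem_iUnion.2 ⟨_, ih, ?_⟩)
          simpa using hcon
        exact nextDigit_mem this
    by_contra hne
    -- By continuity a prefix of the branch is mapped into u, away from v; but y ∈ v lies in the
    -- closure of the image of that prefix.
    obtain ⟨u, v, hu, hv, hzu, hyv, huv⟩ := t2_separation hne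
    have hnhds : (fun z => (f z).1) ⁻¹' u ∈ 𝓝 (z y) :=
      (continuous_fst.comp hf).continuousAt.preimage_mem_nhds (hu.mem_nhds hzu)
    obtain ⟨w, ⟨z', k, rfl⟩, hzw, hsub⟩ :=
      (PiNat.isTopologicalBasis_cylinders (fun _ => ℕ)).mem_nhds_iff.1 hnhds
    have hy := (hmem k).2
    obtain ⟨y', hy'v, z'', hz'', rfl⟩ := mem_closure_iff.1 hy v hv hyv
    refine Set.disjoint_left.1 huv (hsub ?_) hy'v
    rw [PiNat.mem_cylinder_iff] at hzw ⊢
    intro i hi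
    rw [← hzw i hi]
    exact (mem_listCylinder_branchPrefix H k y z'').1 hz'' i hi
  refine ⟨H [] \ N, fun y => (f (z y)).2, (hH _).diff hNm,
    measurable_snd.comp (hf.measurable.comp hz), fun y hy => ⟨z y, Prod.ext (key y hy) rfl⟩, ?_⟩
  have : ∀ᵐ y ∂m, y ∉ N := measure_eq_zero_iff_ae_notMem.1 hN
  filter_upwards [this] with y hy s ⟨w, hw⟩
  exact ⟨hWH [] ⟨w, trivial, by simp [hw]⟩, hy⟩

/-- A supremum over a standard Borel index set of a Borel function is measurable up to a null
set. -/
theorem aemeasurable_iSup_prod {Y S : Type*} [MeasurableSpace Y] [StandardBorelSpace Y]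
    [MeasurableSpace S] [StandardBorelSpace S] (m : Measure Y) [IsFiniteMeasure m]
    {h : Y × S → ℝ≥0∞} (hh : Measurable h) : AEMeasurable (fun y => ⨆ s, h (y, s)) m := by
  rcases isEmpty_or_nonempty S with hS | hS
  · simp only [iSup_of_empty]
    exact aemeasurable_const
  refine NullMeasurable.aemeasurable ?_
  refine measurable_of_Ioi (α := ℝ≥0∞) (δ := NullMeasurableSpace Y m) fun a => ?_
  -- The superlevel set is the projection of a Borel set, hence almost everywhere equal to the
  -- domain of a section.
  obtain ⟨D, r, hD, -, hDr, hae⟩ := exists_measurable_section m (hh (measurableSet_Ioi (a := a)))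
  have : (fun y => ⨆ s, h (y, s)) ⁻¹' Set.Ioi a =ᵐ[m] D := by
    filter_upwards [hae] with y hy
    refine propext ⟨fun h' => ?_, fun h' => ?_⟩
    · obtain ⟨s, hs⟩ := lt_iSup_iff.1 (show a < ⨆ s, h (y, s) from h')
      exact hy s hs
    · exact lt_of_lt_of_le (hDr y h') (le_iSup (fun s => h (y, s)) (r y))
  exact hD.nullMeasurableSet.congr this.symm

end Selection

/-! ### Moments of a ranked packing -/

section Packing

/-- Mean value bound: the increment of x^(k+1) is at most the step times the derivative at the right
endpoint. -/
theorem add_pow_succ_le (a b : ℝ≥0∞) (k : ℕ) :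
    (a + b) ^ (k + 1) ≤ a ^ (k + 1) + (k + 1) * b * (a + b) ^ k := by
  induction k with
  | zero => simp
  | succ k ih =>
    calc (a + b) ^ (k + 1 + 1) = (a + b) ^ (k + 1) * a + b * (a + b) ^ (k + 1) := by ring
      _ ≤ (a ^ (k + 1) + (k + 1) * b * (a + b) ^ k) * a + b * (a + b) ^ (k + 1) := by gcongr
      _ = a ^ (k + 1 + 1) + (k + 1) * b * ((a + b) ^ k * a) + b * (a + b) ^ (k + 1) := by ring
      _ ≤ a ^ (k + 1 + 1) + (k + 1) * b * ((a + b) ^ k * (a + b)) + b * (a + b) ^ (k + 1) := by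
        gcongr
        exact le_self_add
      _ = _ := by push_cast; ring

/-- Expansion of a power of a sum along the term of largest rank. -/
theorem sum_pow_succ_le {O : Type*} (a : O → ℝ≥0∞) (ρ : O → ℝ) (k : ℕ) (s : Finset O) :
    (∑ i ∈ s, a i) ^ (k + 1) ≤
      (k + 1) * ∑ i ∈ s, a i * (∑' j, {j | ρ j ≤ ρ i}.indicator a j) ^ k := by
  classical
  induction s using Finset.induction_on_max_value ρ with
  | empty => simp
  | insert i s hi hmax ih =>
    -- The inserted index has the largest rank, so its lower sum contains every term present.
    have h1 : ∑ j ∈ insert i s, a j ≤ ∑' j, {j | ρ j ≤ ρ i}.indicator a j := by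
      refine le_trans (Finset.sum_le_sum fun j hj => ?_) (ENNReal.sum_le_tsum (insert i s))
      rw [Set.indicator_of_mem]
      rcases Finset.mem_insert.1 hj with rfl | hj
      · exact le_refl (ρ j)
      · exact hmax j hj
    rw [Finset.sum_insert hi] at h1
    rw [Finset.sum_insert hi, Finset.sum_insert hi, add_comm (a i), mul_add]
    refine (add_pow_succ_le _ _ k).trans ?_
    rw [add_comm]
    refine add_le_add ?_ ih
    rw [mul_assoc]
    gcongr
    rwa [add_comm]

theorem tsum_pow_succ_le {O : Type*} (a : O → ℝ≥0∞) (ρ : O → ℝ) (k : ℕ) :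
    (∑' i, a i) ^ (k + 1) ≤
      (k + 1) * ∑' i, a i * (∑' j, {j | ρ j ≤ ρ i}.indicator a j) ^ k := by
  refine le_of_tendsto (((ENNReal.continuous_pow (k + 1)).tendsto _).comp
    ENNReal.summable.hasSum) (Eventually.of_forall fun s => ?_)
  refine (sum_pow_succ_le a ρ k s).trans ?_
  gcongr
  exact ENNReal.sum_le_tsum s

variable {O : Type*} (U : O → Set O) (ρ : O → ℝ)

theorem setCard_eq_tsum (S : Set O) : setCard S = ∑' q, S.indicator 1 q := by
  rw [← tsum_subtype]
  exact (ENNReal.tsum_set_one S).symm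

theorem setCard_ne_top {S : Set O} (h : S.Finite) : setCard S ≠ ∞ := by
  simpa [setCard] using h

theorem setCard_ne_zero {S : Set O} (h : S.Nonempty) : setCard S ≠ 0 := by
  simpa [setCard, Set.encard_eq_zero, Set.nonempty_iff_ne_empty] using h

theorem setCard_mono {S S' : Set O} (h : S ⊆ S') : setCard S ≤ setCard S' := by
  unfold setCard
  exact_mod_cast Set.encard_le_encard h

theorem tsum_indicator_mul_le_setCard (S : Set O) (g : O → ℝ≥0∞) (c : ℝ≥0∞)
    (h : ∀ q ∈ S, g q ≤ c) : ∑' q, S.indicator g q ≤ c * setCard S := by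
  rw [setCard_eq_tsum, ← ENNReal.tsum_mul_left]
  refine ENNReal.tsum_le_tsum fun q => ?_
  by_cases hq : q ∈ S <;> simp [hq, h]

/-- The sum of `1/|U(p)|` over the `p` of rank at most `s` whose set `U(p)` contains `q`. -/
noncomputable def packing (s : ℝ) (q : O) : ℝ≥0∞ :=
  ∑' p, {p | q ∈ U p ∧ ρ p ≤ s}.indicator (fun p => (setCard (U p))⁻¹) p

/-- Bounded overlap of a ranked family: averages over `U(p)` of sums over the lower sets of the
family are controlled by averages over the lower sets. -/
def BoundedOverlap (C : ℝ≥0∞) : Prop :=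
  ∀ (g : ℝ → O → ℝ≥0∞) (K : ℝ≥0∞),
    (∀ p, ∑' q, (U p).indicator (g (ρ p)) q ≤ K * setCard (U p)) → ∀ p,
    ∑' q, (U p).indicator (fun q => ∑' p',
      {p' | q ∈ U p' ∧ ρ p' ≤ ρ p}.indicator (fun p' => (setCard (U p'))⁻¹ * g (ρ p') q) p') q
      ≤ C * K * setCard (U p)

variable {U ρ}

/-- One scale: lower sets that meet `U(p)` contribute at most their number. -/
theorem tsum_lower_le (hfin : ∀ p, (U p).Finite) (P : O → Prop) (g : ℝ → O → ℝ≥0∞) (K : ℝ≥0∞)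
    (hg : ∀ p, ∑' q, (U p).indicator (g (ρ p)) q ≤ K * setCard (U p)) (p : O) :
    ∑' q, (U p).indicator (fun q => ∑' p',
      {p' | q ∈ U p' ∧ P p'}.indicator (fun p' => (setCard (U p'))⁻¹ * g (ρ p') q) p') q
      ≤ K * setCard {p' | P p' ∧ (U p' ∩ U p).Nonempty} := by
  have h1 : ∀ q, (U p).indicator (fun q => ∑' p',
      {p' | q ∈ U p' ∧ P p'}.indicator (fun p' => (setCard (U p'))⁻¹ * g (ρ p') q) p') q =
      ∑' p', {p' | P p' ∧ (U p' ∩ U p).Nonempty}.indicator (fun p' => (setCard (U p'))⁻¹ *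
        (U p' ∩ U p).indicator (g (ρ p')) q) p' := by
    intro q
    by_cases hq : q ∈ U p
    · rw [Set.indicator_of_mem hq]
      refine tsum_congr fun p' => ?_
      by_cases hq' : q ∈ U p'
      · have hne : (U p' ∩ U p).Nonempty := ⟨q, hq', hq⟩
        by_cases hP : P p' <;> simp [hq, hq', hP, hne]
      · by_cases hP : P p' <;> simp [hq, hq', hP, Set.indicator]
    · rw [Set.indicator_of_notMem hq]
      symm
      rw [ENNReal.tsum_eq_zero]
      intro p'
      simp [hq, Set.indicator]
  rw [tsum_congr h1, ENNReal.tsum_comm]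
  -- With the sums exchanged, each p' whose set meets `U p` contributes at most its own average of
  -- g, that is K.
  have h2 : ∀ p', ∑' q, {p' | P p' ∧ (U p' ∩ U p).Nonempty}.indicator (fun p' =>
      (setCard (U p'))⁻¹ * (U p' ∩ U p).indicator (g (ρ p')) q) p' ≤
      {p' | P p' ∧ (U p' ∩ U p).Nonempty}.indicator (fun _ => K) p' := by
    intro p'
    by_cases hp' : P p' ∧ (U p' ∩ U p).Nonempty
    · have hp'' : p' ∈ {p' | P p' ∧ (U p' ∩ U p).Nonempty} := hp'
      simp only [Set.indicator_of_mem hp'', ENNReal.tsum_mul_left]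
      have hc0 : setCard (U p') ≠ 0 := setCard_ne_zero hp'.2.left
      have hct : setCard (U p') ≠ ∞ := setCard_ne_top (hfin p')
      calc (setCard (U p'))⁻¹ * ∑' q, (U p' ∩ U p).indicator (g (ρ p')) q
          ≤ (setCard (U p'))⁻¹ * (K * setCard (U p')) := by
            gcongr
            refine (ENNReal.tsum_le_tsum fun q => ?_).trans (hg p')
            exact Set.indicator_le_indicator_of_subset Set.inter_subset_left
              (fun _ => zero_le) q
        _ = K := by
            rw [mul_comm K, ← mul_assoc, ENNReal.inv_mul_cancel hc0 hct, one_mul]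
    · have hp'' : p' ∉ {p' | P p' ∧ (U p' ∩ U p).Nonempty} := hp'
      simp [Set.indicator_of_notMem hp'']
  exact (ENNReal.tsum_le_tsum h2).trans (tsum_indicator_mul_le_setCard _ _ _ fun _ _ => le_rfl)

theorem boundedOverlap_of_regular (hfin : ∀ p, (U p).Finite) {C : ℝ≥0∞}
    (h : ∀ p, setCard {p' | ρ p' ≤ ρ p ∧ (U p' ∩ U p).Nonempty} ≤ C * setCard (U p)) :
    BoundedOverlap U ρ C := by
  intro g K hg p
  refine (tsum_lower_le hfin (fun p' => ρ p' ≤ ρ p) g K hg p).trans ?_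
  calc _ ≤ K * (C * setCard (U p)) := by gcongr; exact h p
    _ = _ := by ring

/-- Counting meeting sets works only below the rank of p. At equal rank the test function is the
single function g (ρ p), which factors out of the sum over p'; what remains is a packing at one
scale, bounded by D. -/
theorem boundedOverlap_of_tempered (hfin : ∀ p, (U p).Finite) {C D : ℝ≥0∞}
    (h : ∀ p, setCard {p' | ρ p' < ρ p ∧ (U p' ∩ U p).Nonempty} ≤ C * setCard (U p))
    (hD : ∀ p q, ∑' p', {p' | q ∈ U p' ∧ ρ p' = ρ p}.indicator (fun p' => (setCard (U p'))⁻¹) p'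
      ≤ D) :
    BoundedOverlap U ρ (C + D) := by
  intro g K hg p
  have h1 : ∀ q, (U p).indicator (fun q => ∑' p', {p' | q ∈ U p' ∧ ρ p' ≤ ρ p}.indicator
      (fun p' => (setCard (U p'))⁻¹ * g (ρ p') q) p') q ≤
      (U p).indicator (fun q => ∑' p', {p' | q ∈ U p' ∧ ρ p' < ρ p}.indicator
        (fun p' => (setCard (U p'))⁻¹ * g (ρ p') q) p') q +
      D * (U p).indicator (g (ρ p)) q := by
    intro q
    by_cases hq : q ∈ U p
    · simp only [Set.indicator_of_mem hq]
      calc _ ≤ ∑' p', ({p' | q ∈ U p' ∧ ρ p' < ρ p}.indicator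
              (fun p' => (setCard (U p'))⁻¹ * g (ρ p') q) p' +
            {p' | q ∈ U p' ∧ ρ p' = ρ p}.indicator (fun p' => (setCard (U p'))⁻¹) p' *
              g (ρ p) q) := by
            refine ENNReal.tsum_le_tsum fun p' => ?_
            by_cases hq' : q ∈ U p'
            · rcases lt_trichotomy (ρ p') (ρ p) with hlt | heq | hgt
              · simp [Set.indicator, hq', hlt, hlt.le]
              · simp [Set.indicator, hq', heq]
              · simp [Set.indicator, hgt.not_ge]
            · simp [Set.indicator, hq']
        _ ≤ _ := by
            rw [ENNReal.tsum_add, ENNReal.tsum_mul_right]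
            gcongr
            exact hD p q
    · simp [hq]
  refine (ENNReal.tsum_le_tsum h1).trans ?_
  rw [ENNReal.tsum_add, ENNReal.tsum_mul_left]
  calc _ ≤ K * (C * setCard (U p)) + D * (K * setCard (U p)) := by
        gcongr
        · refine (tsum_lower_le hfin (fun p' => ρ p' < ρ p) g K hg p).trans ?_
          gcongr
          exact h p
        · exact hg p
    _ = _ := by ring

/-- For p of rank at most s the truncation at s is absorbed by the one at ρ p. The inner power is
thus taken at the rank of p itself, the form required by `BoundedOverlap`. -/
theorem packing_pow_succ_le (s : ℝ) (q : O) (k : ℕ) :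
    packing U ρ s q ^ (k + 1) ≤ (k + 1) * ∑' p, {p | q ∈ U p ∧ ρ p ≤ s}.indicator
      (fun p => (setCard (U p))⁻¹ * packing U ρ (ρ p) q ^ k) p := by
  refine (tsum_pow_succ_le _ ρ k).trans ?_
  gcongr with p
  by_cases hp : q ∈ U p ∧ ρ p ≤ s
  · have hp' : p ∈ {p | q ∈ U p ∧ ρ p ≤ s} := hp
    rw [Set.indicator_of_mem hp', Set.indicator_of_mem hp']
    gcongr
    refine ENNReal.tsum_le_tsum fun p' => ?_
    by_cases h1 : ρ p' ≤ ρ p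
    · by_cases h2 : q ∈ U p'
      · simp [Set.indicator, h1, h2, h1.trans hp.2]
      · simp [Set.indicator, h1, h2]
    · simp [Set.indicator, h1]
  · simp [Set.indicator, hp]

/-- The moments of the packing function over the sets of the family. -/
theorem tsum_packing_pow_le {C : ℝ≥0∞} (hU : BoundedOverlap U ρ C) (k : ℕ) (p : O) :
    ∑' q, (U p).indicator (fun q => packing U ρ (ρ p) q ^ k) q
      ≤ (k.factorial : ℝ≥0∞) * C ^ k * setCard (U p) := by
  induction k generalizing p with
  | zero =>
    simp only [pow_zero, Nat.factorial_zero, Nat.cast_one, one_mul]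
    exact (setCard_eq_tsum _).ge
  | succ k ih =>
    -- The induction hypothesis is exactly the premise of bounded overlap for g the k-th power of
    -- the packing function and K = k! C^k.
    have h := hU (fun s q => packing U ρ s q ^ k) _ ih p
    calc _ ≤ ∑' q, (k + 1) * (U p).indicator (fun q => ∑' p',
          {p' | q ∈ U p' ∧ ρ p' ≤ ρ p}.indicator
            (fun p' => (setCard (U p'))⁻¹ * packing U ρ (ρ p') q ^ k) p') q := by
          refine ENNReal.tsum_le_tsum fun q => ?_
          by_cases hq : q ∈ U p
          · simp only [Set.indicator_of_mem hq]
            exact packing_pow_succ_le _ _ _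
          · simp [hq]
      _ ≤ (k + 1) * (C * ((k.factorial : ℝ≥0∞) * C ^ k) * setCard (U p)) := by
          rw [ENNReal.tsum_mul_left]
          gcongr
      _ = _ := by
          rw [Nat.factorial_succ]
          push_cast
          ring

end Packing

/-! ### Countable measure-preserving equivalence relations -/

section OrbitChart

variable {Y ι : Type*} [MeasurableSpace Y]

/-- Countably many partial maps `φ i`, defined on `A i`, that enumerate the classes of `R`, almost
everywhere without repetition, and satisfy the mass transport principle for `m`. -/
structure OrbitChart (m : Measure Y) (R : Y → Y → Prop) (A : ι → Set Y) (φ : ι → Y → Y) :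
    Prop where
  equivalence : Equivalence R
  measurableSet : ∀ i, MeasurableSet (A i)
  measurable : ∀ i, Measurable (φ i)
  rel_iff : ∀ p q, R p q ↔ ∃ i, p ∈ A i ∧ φ i p = q
  ae_injOn : ∀ᵐ p ∂m, Set.InjOn (fun i => φ i p) {i | p ∈ A i}
  transport : ∀ Φ : Y × Y → ℝ≥0∞, Measurable Φ →
    ∫⁻ p, ∑' i, (A i).indicator (fun p => Φ (p, φ i p)) p ∂m =
      ∫⁻ q, ∑' i, (A i).indicator (fun q => Φ (φ i q, q)) q ∂m

/-- A kernel that agrees with a Borel one on almost every class, uniformly in a parameter. -/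
def ClassMeasurable {S : Type*} [MeasurableSpace S] (m : Measure Y) (R : Y → Y → Prop)
    (Φ : S → Y → Y → ℝ≥0∞) : Prop :=
  ∃ Φ' : S × Y × Y → ℝ≥0∞, Measurable Φ' ∧ ∀ᵐ p ∂m, ∀ q, R p q → ∀ s, Φ s p q = Φ' (s, p, q)

/-- A set-valued kernel that agrees with a Borel one on almost every class, uniformly in a
parameter. -/
def ClassMeasurableSet {S : Type*} [MeasurableSpace S] (m : Measure Y) (R : Y → Y → Prop)
    (U : S → Y → Set Y) : Prop :=
  ∃ V : Set (S × Y × Y), MeasurableSet V ∧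
    ∀ᵐ p ∂m, ∀ q, R p q → ∀ s, q ∈ U s p ↔ (s, p, q) ∈ V

/-! ### Null sets, measurability and mass transport along classes -/

namespace OrbitChart

variable {m : Measure Y} {R : Y → Y → Prop} {A : ι → Set Y} {φ : ι → Y → Y}

/-- The exceptional null set is where the enumeration of the class has repetitions. It does not
depend on Ψ, which may therefore vary with p and with a parameter. -/
theorem ae_tsum_eq (h : OrbitChart m R A φ) : ∀ᵐ p ∂m, ∀ Ψ : Y → ℝ≥0∞,
    (∀ q, Ψ q ≠ 0 → R p q) → ∑' q, Ψ q = ∑' i, (A i).indicator (fun p => Ψ (φ i p)) p := by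
  filter_upwards [h.ae_injOn] with p hp Ψ hΨ
  have h1 : ∀ i, (A i).indicator (fun p => Ψ (φ i p)) p =
      {i | p ∈ A i}.indicator (fun i => Ψ (φ i p)) i := by
    intro i
    by_cases hi : p ∈ A i <;> simp [hi]
  rw [tsum_congr h1, ← tsum_subtype]
  have hinj : Function.Injective fun i : {i | p ∈ A i} => φ i p := fun i j hij =>
    Subtype.ext (hp i.2 j.2 hij)
  refine (hinj.tsum_eq (f := Ψ) fun q hq => ?_).symm
  obtain ⟨i, hi, rfl⟩ := (h.rel_iff p q).1 (hΨ q hq)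
  exact ⟨⟨i, hi⟩, rfl⟩

variable [Countable ι]

/-- The saturation of a null set is null: transport the indicator of the null set along the chart.
-/
theorem ae_class (h : OrbitChart m R A φ) {P : Y → Prop} (hP : ∀ᵐ p ∂m, P p) :
    ∀ᵐ p ∂m, ∀ q, R p q → P q := by
  let N := toMeasurable m {p | ¬ P p}
  have hN : m N = 0 := by rw [measure_toMeasurable]; exact hP
  have hNm : MeasurableSet N := measurableSet_toMeasurable _ _
  have hΦ : Measurable fun z : Y × Y => N.indicator (1 : Y → ℝ≥0∞) z.2 :=
    (measurable_one.indicator hNm).comp measurable_snd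
  have h1 := h.transport _ hΦ
  have h2 : ∫⁻ q, ∑' i, (A i).indicator (fun q => N.indicator (1 : Y → ℝ≥0∞) q) q ∂m = 0 := by
    refine (lintegral_congr_ae ?_).trans lintegral_zero
    filter_upwards [measure_eq_zero_iff_ae_notMem.1 hN] with q hq
    rw [ENNReal.tsum_eq_zero]
    intro i
    simp [Set.indicator, hq]
  simp only at h1
  rw [h2, lintegral_eq_zero_iff] at h1
  · filter_upwards [h1] with p hp q hq
    obtain ⟨i, hi, rfl⟩ := (h.rel_iff p q).1 hq
    have h3 := ENNReal.tsum_eq_zero.1 hp i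
    rw [Set.indicator_of_mem hi] at h3
    by_contra hcon
    have : φ i p ∈ N := subset_toMeasurable _ _ hcon
    simp [this] at h3
  · refine Measurable.tsum fun i => Measurable.indicator ?_ (h.measurableSet i)
    exact (measurable_one.indicator hNm).comp (h.measurable i)

theorem ae_class₂ (h : OrbitChart m R A φ) {P : Y → Y → Prop}
    (hP : ∀ᵐ p ∂m, ∀ q, R p q → P p q) : ∀ᵐ q ∂m, ∀ p, R q p → P p q := by
  filter_upwards [h.ae_class hP] with q hq p hp
  exact hq p hp q (h.equivalence.symm hp)

/-- Joint measurability, with one null set for all s, is what allows substituting s = r(p) or taking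
suprema over uncountably many s. -/
theorem exists_measurable_tsum (h : OrbitChart m R A φ) {S : Type*} [MeasurableSpace S]
    {Φ : S → Y → Y → ℝ≥0∞} (hR : ∀ s p q, Φ s p q ≠ 0 → R p q) (hΦ : ClassMeasurable m R Φ) :
    ∃ G : S × Y → ℝ≥0∞, Measurable G ∧ ∀ᵐ p ∂m, ∀ s, ∑' q, Φ s p q = G (s, p) := by
  obtain ⟨Φ', hΦ'm, hΦ'⟩ := hΦ
  refine ⟨fun z => ∑' i, ((fun z : S × Y => z.2) ⁻¹' A i).indicator
    (fun z => Φ' (z.1, z.2, φ i z.2)) z, ?_, ?_⟩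
  · refine Measurable.tsum fun i => Measurable.indicator ?_
      (measurable_snd (h.measurableSet i))
    exact hΦ'm.comp (measurable_fst.prodMk (measurable_snd.prodMk
      ((h.measurable i).comp measurable_snd)))
  · filter_upwards [hΦ', h.ae_tsum_eq] with p h1 h2 s
    rw [h2 _ (hR s p)]
    refine tsum_congr fun i => ?_
    by_cases hi : p ∈ A i
    · simp [hi, h1 _ ((h.rel_iff p _).2 ⟨i, hi, rfl⟩) s]
    · simp [hi]

theorem lintegral_tsum_comm (h : OrbitChart m R A φ) {Φ : Y → Y → ℝ≥0∞}
    (hR : ∀ p q, Φ p q ≠ 0 → R p q) (hΦ : ClassMeasurable m R fun _ : Unit => Φ) :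
    ∫⁻ p, ∑' q, Φ p q ∂m = ∫⁻ q, ∑' p, Φ p q ∂m := by
  obtain ⟨Φ', hΦ'm, hΦ'⟩ := hΦ
  have h1 := h.transport (fun z => Φ' ((), z)) (hΦ'm.comp (measurable_const.prodMk measurable_id))
  have h2 : ∀ᵐ p ∂m, ∑' q, Φ p q = ∑' i, (A i).indicator (fun p => Φ' ((), p, φ i p)) p := by
    filter_upwards [hΦ', h.ae_tsum_eq] with p h1 h2
    rw [h2 _ (hR p)]
    refine tsum_congr fun i => ?_
    by_cases hi : p ∈ A i
    · simp [hi, h1 _ ((h.rel_iff p _).2 ⟨i, hi, rfl⟩) ()]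
    · simp [hi]
  have h3 : ∀ᵐ q ∂m, ∑' p, Φ p q = ∑' i, (A i).indicator (fun q => Φ' ((), φ i q, q)) q := by
    filter_upwards [h.ae_class₂ hΦ', h.ae_tsum_eq] with q h1 h2
    rw [h2 (fun p => Φ p q) fun p hp => h.equivalence.symm (hR p q hp)]
    refine tsum_congr fun i => ?_
    by_cases hi : q ∈ A i
    · simp [hi, h1 _ ((h.rel_iff q _).2 ⟨i, hi, rfl⟩) ()]
    · simp [hi]
  rw [lintegral_congr_ae h2, lintegral_congr_ae h3]
  exact h1

theorem classMeasurable_indicator {S : Type*} [MeasurableSpace S] {U : S → Y → Set Y}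
    (hU : ClassMeasurableSet m R U) {Φ : S → Y → Y → ℝ≥0∞} (hΦ : ClassMeasurable m R Φ) :
    ClassMeasurable m R fun s p q => (U s p).indicator (Φ s p) q := by
  obtain ⟨V, hV, hUV⟩ := hU
  obtain ⟨Φ', hΦ'm, hΦ'⟩ := hΦ
  refine ⟨V.indicator Φ', hΦ'm.indicator hV, ?_⟩
  filter_upwards [hUV, hΦ'] with p h1 h2 q hq s
  by_cases hqU : q ∈ U s p
  · rw [Set.indicator_of_mem hqU, Set.indicator_of_mem ((h1 q hq s).1 hqU), h2 q hq s]
  · rw [Set.indicator_of_notMem hqU, Set.indicator_of_notMem fun h => hqU ((h1 q hq s).2 h)]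

theorem classMeasurable_right (h : OrbitChart m R A φ) {S : Type*} [MeasurableSpace S]
    {f : Y → ℝ≥0∞} (hf : AEMeasurable f m) : ClassMeasurable m R fun (_ : S) _ q => f q := by
  refine ⟨fun z => hf.mk f z.2.2,
    hf.measurable_mk.comp (measurable_snd.comp measurable_snd), ?_⟩
  filter_upwards [h.ae_class hf.ae_eq_mk] with p hp q hq _
  exact hp q hq

theorem exists_measurable_subsetAverage (h : OrbitChart m R A φ) {S : Type*} [MeasurableSpace S]
    {U : S → Y → Set Y} (hR : ∀ s p q, q ∈ U s p → R p q) (hU : ClassMeasurableSet m R U)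
    {f : Y → ℝ≥0∞} (hf : AEMeasurable f m) :
    ∃ G : S × Y → ℝ≥0∞, Measurable G ∧ ∀ᵐ p ∂m, ∀ s, subsetAverage f (U s) p = G (s, p) := by
  have hsupp : ∀ (g : Y → ℝ≥0∞) (s : S) (p q : Y), (U s p).indicator g q ≠ 0 → R p q := by
    intro g s p q hq
    exact hR s p q (Set.mem_of_indicator_ne_zero hq)
  obtain ⟨G₁, hG₁, h₁⟩ := h.exists_measurable_tsum (hsupp f)
    (classMeasurable_indicator hU (h.classMeasurable_right hf))
  obtain ⟨G₂, hG₂, h₂⟩ := h.exists_measurable_tsum (hsupp 1)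
    (classMeasurable_indicator hU (h.classMeasurable_right aemeasurable_one))
  refine ⟨fun z => G₁ z / G₂ z, hG₁.div hG₂, ?_⟩
  filter_upwards [h₁, h₂] with p hp₁ hp₂ s
  rw [← hp₁, ← hp₂, subsetAverage, tsum_subtype, setCard_eq_tsum]

end OrbitChart

/-! ### The adjoint of a linearized maximal operator -/

/-- The sum of `1/|U(p)|` over the `p` whose set `U(p)` contains `q`. -/
noncomputable def totalPacking (U : Y → Set Y) (q : Y) : ℝ≥0∞ :=
  ∑' p, {p | q ∈ U p}.indicator (fun p => (setCard (U p))⁻¹) p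

namespace OrbitChart

variable {m : Measure Y} {R : Y → Y → Prop} {A : ι → Set Y} {φ : ι → Y → Y} [Countable ι]
  {U : Y → Set Y} {ρ : Y → ℝ}

theorem aemeasurable_setCard (h : OrbitChart m R A φ) (hR : ∀ p q, q ∈ U p → R p q)
    (hU : ClassMeasurableSet m R fun _ : Unit => U) :
    AEMeasurable (fun p => setCard (U p)) m := by
  obtain ⟨G, hG, h'⟩ := h.exists_measurable_tsum (Φ := fun _ p q => (U p).indicator 1 q)
    (fun _ p q hq => hR p q (Set.mem_of_indicator_ne_zero hq))
    (classMeasurable_indicator hU (h.classMeasurable_right aemeasurable_one))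
  refine ⟨fun p => G ((), p), hG.comp (measurable_const.prodMk measurable_id), ?_⟩
  filter_upwards [h'] with p hp
  rw [setCard_eq_tsum, hp]

theorem exists_measurable_packing (h : OrbitChart m R A φ) (hR : ∀ p q, q ∈ U p → R p q)
    (hU : ClassMeasurableSet m R fun _ : Unit => U) (hρ : Measurable ρ) :
    ∃ G : ℝ × Y → ℝ≥0∞, Measurable G ∧ ∀ᵐ q ∂m, ∀ s, packing U ρ s q = G (s, q) := by
  have hc := h.aemeasurable_setCard hR hU
  refine h.exists_measurable_tsum
    (Φ := fun s q p => {p | q ∈ U p ∧ ρ p ≤ s}.indicator (fun p => (setCard (U p))⁻¹) p)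
    (fun s q p hp => ?_) ?_
  · exact h.equivalence.symm (hR p q (Set.mem_of_indicator_ne_zero hp).1)
  · obtain ⟨V, hV, hUV⟩ := hU
    refine ⟨{z | ((), z.2.2, z.2.1) ∈ V ∧ ρ z.2.2 ≤ z.1}.indicator
      (fun z => (hc.mk _ z.2.2)⁻¹), ?_, ?_⟩
    · refine Measurable.indicator ?_ (MeasurableSet.inter ?_ ?_)
      · exact (hc.measurable_mk.comp (measurable_snd.comp measurable_snd)).inv
      · exact (measurable_const.prodMk ((measurable_snd.comp measurable_snd).prodMk
          (measurable_fst.comp measurable_snd))) hV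
      · exact measurableSet_le (hρ.comp (measurable_snd.comp measurable_snd)) measurable_fst
    · filter_upwards [h.ae_class₂ hUV, h.ae_class hc.ae_eq_mk] with q h1 h2 p hp s
      have h3 := h1 p hp ()
      by_cases hq : q ∈ U p
      · by_cases hs : ρ p ≤ s
        · simp [Set.indicator, hq, hs, h3.1 hq, ← h2 p hp]
        · simp [Set.indicator, hs]
      · have hq' : ((), p, q) ∉ V := fun h => hq (h3.2 h)
        simp [Set.indicator, hq, hq']

/-- The pairing of averages over `U(p)` with the packing function. -/
theorem lintegral_average_eq (h : OrbitChart m R A φ) (hR : ∀ p q, q ∈ U p → R p q)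
    (hU : ClassMeasurableSet m R fun _ : Unit => U) {f : Y → ℝ≥0∞} (hf : AEMeasurable f m) :
    ∫⁻ p, subsetAverage f U p ∂m = ∫⁻ q, f q * totalPacking U q ∂m := by
  have hc := h.aemeasurable_setCard hR hU
  -- Each p sends the mass f(q)/|U(p)| to every q ∈ U(p).
  have h1 := h.lintegral_tsum_comm
    (Φ := fun p q => (U p).indicator (fun q => (setCard (U p))⁻¹ * f q) q)
    (fun p q hq => hR p q (Set.mem_of_indicator_ne_zero hq))
    (classMeasurable_indicator (U := fun _ : Unit => U) hU
      (Φ := fun _ p q => (setCard (U p))⁻¹ * f q) ?_)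
  · convert! h1 using 3 with p q
    · rw [subsetAverage, tsum_subtype, div_eq_mul_inv, mul_comm, ← ENNReal.tsum_mul_left]
      refine tsum_congr fun q => ?_
      by_cases hq : q ∈ U p <;> simp [hq]
    · rw [totalPacking, mul_comm, ← ENNReal.tsum_mul_right]
      refine tsum_congr fun p => ?_
      by_cases hq : q ∈ U p <;> simp [Set.indicator, hq]
  · refine ⟨fun z => (hc.mk _ z.2.1)⁻¹ * hf.mk f z.2.2, ?_, ?_⟩
    · exact (hc.measurable_mk.comp (measurable_fst.comp measurable_snd)).inv.mul
        (hf.measurable_mk.comp (measurable_snd.comp measurable_snd))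
    · filter_upwards [hc.ae_eq_mk, h.ae_class hf.ae_eq_mk] with p h1 h2 q hq _
      simp only [h1, h2 q hq]

/-- The moments of the packing function. -/
theorem lintegral_totalPacking_pow_le (h : OrbitChart m R A φ) (hR : ∀ p q, q ∈ U p → R p q)
    (hU : ClassMeasurableSet m R fun _ : Unit => U) (hρ : Measurable ρ)
    (hfin : ∀ p, (U p).Finite) {C : ℝ≥0∞} (hC : BoundedOverlap U ρ C) {E : Set Y}
    (hE : MeasurableSet E) (hUE : ∀ p, (U p).Nonempty → p ∈ E) (k : ℕ) :
    ∫⁻ q, totalPacking U q ^ (k + 1) ∂m ≤ ((k + 1).factorial : ℝ≥0∞) * C ^ k * m E := by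
  have hc := h.aemeasurable_setCard hR hU
  obtain ⟨G, hG, hG'⟩ := h.exists_measurable_packing hR hU hρ
  -- The mass sent from p to q ∈ U(p) is the packing at rank ρ p, to the power k, over |U(p)|. What
  -- q receives, times k+1, dominates the power of N; what p sends is an average over U(p), at most
  -- k! C^k, and vanishes off E.
  have h1 := h.lintegral_tsum_comm
    (Φ := fun p q => (U p).indicator
      (fun q => (setCard (U p))⁻¹ * packing U ρ (ρ p) q ^ k) q)
    (fun p q hq => hR p q (Set.mem_of_indicator_ne_zero hq))
    (classMeasurable_indicator (U := fun _ : Unit => U) hU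
      (Φ := fun _ p q => (setCard (U p))⁻¹ * packing U ρ (ρ p) q ^ k) ?_)
  · calc ∫⁻ q, totalPacking U q ^ (k + 1) ∂m
        ≤ ∫⁻ q, (k + 1) * ∑' p, (U p).indicator
            (fun q => (setCard (U p))⁻¹ * packing U ρ (ρ p) q ^ k) q ∂m := by
          refine lintegral_mono fun q => (tsum_pow_succ_le _ ρ k).trans ?_
          gcongr with p
          by_cases hq : q ∈ U p
          · rw [Set.indicator_of_mem hq]
            rw [Set.indicator_of_mem (show p ∈ {p | q ∈ U p} from hq)]
            gcongr
            refine ENNReal.tsum_le_tsum fun p' => ?_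
            by_cases h1 : ρ p' ≤ ρ p <;> by_cases h2 : q ∈ U p' <;>
              simp [Set.indicator, h1, h2]
          · simp [Set.indicator, hq]
      _ = (k + 1) * ∫⁻ p, ∑' q, (U p).indicator
            (fun q => (setCard (U p))⁻¹ * packing U ρ (ρ p) q ^ k) q ∂m := by
          rw [lintegral_const_mul' _ _ (by finiteness), h1]
      _ ≤ (k + 1) * ∫⁻ p, E.indicator (fun _ => (k.factorial : ℝ≥0∞) * C ^ k) p ∂m := by
          gcongr with p
          by_cases hne : (U p).Nonempty
          · rw [Set.indicator_of_mem (hUE p hne)]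
            have h2 := tsum_packing_pow_le hC k p
            calc ∑' q, (U p).indicator
                  (fun q => (setCard (U p))⁻¹ * packing U ρ (ρ p) q ^ k) q
                = (setCard (U p))⁻¹ * ∑' q, (U p).indicator
                    (fun q => packing U ρ (ρ p) q ^ k) q := by
                  rw [← ENNReal.tsum_mul_left]
                  refine tsum_congr fun q => ?_
                  by_cases hq : q ∈ U p <;> simp [hq]
              _ ≤ (setCard (U p))⁻¹ * ((k.factorial : ℝ≥0∞) * C ^ k * setCard (U p)) := by
                  gcongr
              _ = _ := by
                  rw [mul_comm _ (setCard (U p)), ← mul_assoc,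
                    ENNReal.inv_mul_cancel (setCard_ne_zero hne) (setCard_ne_top (hfin p)),
                    one_mul]
          · simp [Set.not_nonempty_iff_eq_empty.1 hne]
      _ = _ := by
          rw [lintegral_indicator_const hE, Nat.factorial_succ]
          push_cast
          ring
  · refine ⟨fun z => (hc.mk _ z.2.1)⁻¹ * G (ρ z.2.1, z.2.2) ^ k, ?_, ?_⟩
    · refine (hc.measurable_mk.comp (measurable_fst.comp measurable_snd)).inv.mul
        (Measurable.pow_const ?_ k)
      exact hG.comp ((hρ.comp (measurable_fst.comp measurable_snd)).prodMk
        (measurable_snd.comp measurable_snd))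
    · filter_upwards [hc.ae_eq_mk, h.ae_class hG'] with p h1 h2 q hq _
      simp only [h1, h2 q hq]

theorem aemeasurable_totalPacking (h : OrbitChart m R A φ) (hR : ∀ p q, q ∈ U p → R p q)
    (hU : ClassMeasurableSet m R fun _ : Unit => U) :
    AEMeasurable (totalPacking U) m := by
  -- With all ranks zero, truncation at rank 0 removes nothing.
  obtain ⟨G, hG, hG'⟩ := h.exists_measurable_packing (ρ := 0) hR hU measurable_zero
  refine ⟨fun q => G (0, q), hG.comp (measurable_const.prodMk measurable_id), ?_⟩
  filter_upwards [hG'] with q hq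
  rw [← hq 0, packing, totalPacking]
  simp

end OrbitChart

end OrbitChart

/-! ### Interpolation and Young inequalities -/

section Interpolation

variable {Y : Type*} [MeasurableSpace Y] {m : Measure Y}

/-- Marcinkiewicz interpolation with `L^∞`, from a weak-type bound for truncated functions. -/
theorem lintegral_rpow_le_of_weak_type {f : Y → ℝ} {M : Y → ℝ≥0∞} (hf : AEMeasurable f m)
    (hf0 : ∀ x, 0 ≤ f x) (hM : AEMeasurable M m) {D : ℝ≥0∞} {s p : ℝ} (hs : 0 ≤ s)
    (hp : 1 + s < p)
    (hw : ∀ t : ℝ, 0 < t → m {x | ENNReal.ofReal t < M x} ≤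
      D * ∫⁻ x in {x | t < 2 * f x}, ENNReal.ofReal ((f x / t) ^ (1 + s)) ∂m) :
    ∫⁻ x, M x ^ p ∂m ≤
      D * (ENNReal.ofReal p * (ENNReal.ofReal (p - 1 - s))⁻¹ * ENNReal.ofReal (2 ^ (p - 1 - s))) *
        ∫⁻ x, ENNReal.ofReal (f x ^ p) ∂m := by
  have hp0 : 0 < p := by linarith
  have hps : 0 < p - 1 - s := by linarith
  -- Weighting by f^(1+s) turns the weak-type bound into the κ-measure of {2f > t} times a power of
  -- t. The layer-cake formula then applies again, to 2f with the positive exponent p - 1 - s.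
  set κ := m.withDensity fun x => ENNReal.ofReal (f x ^ (1 + s)) with hκ
  have hfs : AEMeasurable (fun x => ENNReal.ofReal (f x ^ (1 + s))) m :=
    (hf.pow_const _).ennreal_ofReal
  have hκf : AEMeasurable (fun x => 2 * f x) κ :=
    (hf.const_mul 2).mono' (withDensity_absolutelyContinuous _ _)
  have hset : ∀ t : ℝ, NullMeasurableSet {x | t < 2 * f x} m := fun t =>
    nullMeasurableSet_lt aemeasurable_const (hf.const_mul 2)
  have h1 : ∫⁻ x, ENNReal.ofReal ((2 * f x) ^ (p - 1 - s)) ∂κ =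
      ENNReal.ofReal (2 ^ (p - 1 - s)) * ∫⁻ x, ENNReal.ofReal (f x ^ p) ∂m := by
    rw [hκ, lintegral_withDensity_eq_lintegral_mul₀ hfs
      (((hf.const_mul 2).pow_const _).ennreal_ofReal),
      ← lintegral_const_mul'' _ (hf.pow_const _).ennreal_ofReal]
    refine lintegral_congr fun x => ?_
    rw [Pi.mul_apply, ← ENNReal.ofReal_mul (by have := hf0 x; positivity),
      ← ENNReal.ofReal_mul (by positivity), Real.mul_rpow (by norm_num) (hf0 x)]
    congr 1
    rw [mul_left_comm, ← Real.rpow_add_of_nonneg (hf0 x) (by linarith) hps.le]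
    ring_nf
  have h2 : ∫⁻ t in Set.Ioi (0 : ℝ), κ {x | t < 2 * f x} * ENNReal.ofReal (t ^ (p - 1 - s - 1)) =
      (ENNReal.ofReal (p - 1 - s))⁻¹ * (ENNReal.ofReal (2 ^ (p - 1 - s)) *
        ∫⁻ x, ENNReal.ofReal (f x ^ p) ∂m) := by
    rw [← h1, lintegral_rpow_eq_lintegral_meas_lt_mul κ
      (ae_of_all _ fun x => by have := hf0 x; simp [this]) hκf hps, ← mul_assoc,
      ENNReal.inv_mul_cancel (ENNReal.ofReal_pos.2 hps).ne' ENNReal.ofReal_ne_top, one_mul]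
  -- M may be infinite, while the layer-cake formula concerns real functions; the truncation is
  -- removed by monotone convergence.
  have hn : ∀ n : ℕ, ∫⁻ x, (min (M x) n) ^ p ∂m ≤
      D * (ENNReal.ofReal p * (ENNReal.ofReal (p - 1 - s))⁻¹ *
        ENNReal.ofReal (2 ^ (p - 1 - s))) * ∫⁻ x, ENNReal.ofReal (f x ^ p) ∂m := by
    intro n
    have hfin : ∀ x, min (M x) n ≠ ∞ := fun x =>
      ((min_le_right _ _).trans_lt (ENNReal.natCast_lt_top n)).ne
    calc ∫⁻ x, (min (M x) n) ^ p ∂m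
        = ∫⁻ x, ENNReal.ofReal ((min (M x) n).toReal ^ p) ∂m := by
          refine lintegral_congr fun x => ?_
          rw [← ENNReal.ofReal_rpow_of_nonneg ENNReal.toReal_nonneg hp0.le,
            ENNReal.ofReal_toReal (hfin x)]
      _ = ENNReal.ofReal p * ∫⁻ t in Set.Ioi (0 : ℝ),
            m {x | t < (min (M x) n).toReal} * ENNReal.ofReal (t ^ (p - 1)) :=
          lintegral_rpow_eq_lintegral_meas_lt_mul m (ae_of_all _ fun x => ENNReal.toReal_nonneg)
            (hM.min aemeasurable_const).ennreal_toReal hp0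
      _ ≤ ENNReal.ofReal p * ∫⁻ t in Set.Ioi (0 : ℝ),
            D * (κ {x | t < 2 * f x} * ENNReal.ofReal (t ^ (p - 1 - s - 1))) := by
          refine mul_le_mul_right (setLIntegral_mono' measurableSet_Ioi fun t ht => ?_) _
          have ht0 : 0 < t := ht
          have h3 : ∫⁻ x in {x | t < 2 * f x}, ENNReal.ofReal ((f x / t) ^ (1 + s)) ∂m =
              κ {x | t < 2 * f x} * ENNReal.ofReal (t ^ (-(1 + s))) := by
            rw [hκ, withDensity_apply₀ _ (hset t), ← lintegral_mul_const'' _ hfs.restrict]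
            refine lintegral_congr fun x => ?_
            rw [← ENNReal.ofReal_mul (Real.rpow_nonneg (hf0 x) _), Real.div_rpow (hf0 x) ht0.le,
              Real.rpow_neg ht0.le, div_eq_mul_inv]
          calc _ ≤ m {x | ENNReal.ofReal t < M x} * ENNReal.ofReal (t ^ (p - 1)) := by
                gcongr
                intro hlt
                exact ((ENNReal.ofReal_lt_iff_lt_toReal ht0.le (hfin _)).2 hlt).trans_le
                  (min_le_left _ _)
            _ ≤ D * (κ {x | t < 2 * f x} * ENNReal.ofReal (t ^ (-(1 + s)))) *
                  ENNReal.ofReal (t ^ (p - 1)) := by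
                rw [← h3]
                gcongr
                exact hw t ht0
            _ = D * (κ {x | t < 2 * f x} * (ENNReal.ofReal (t ^ (-(1 + s))) *
                  ENNReal.ofReal (t ^ (p - 1)))) := by ring
            _ = _ := by
                rw [← ENNReal.ofReal_mul (by positivity), ← Real.rpow_add ht0]
                ring_nf
      _ ≤ ENNReal.ofReal p * (D * ∫⁻ t in Set.Ioi (0 : ℝ),
            κ {x | t < 2 * f x} * ENNReal.ofReal (t ^ (p - 1 - s - 1))) := by
          rw [lintegral_const_mul]
          refine Measurable.mul ?_ (by fun_prop)
          exact Antitone.measurable fun a b hab => measure_mono fun x hx => lt_of_le_of_lt hab hx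
      _ = _ := by
          rw [h2]
          ring
  have hlim : ∫⁻ x, M x ^ p ∂m = ⨆ n : ℕ, ∫⁻ x, (min (M x) n) ^ p ∂m := by
    rw [← lintegral_iSup']
    · refine lintegral_congr fun x => ?_
      have : M x = ⨆ n : ℕ, min (M x) n := by
        rw [← inf_iSup_eq, ENNReal.iSup_natCast, inf_top_eq]
      conv_lhs => rw [this]
      exact (ENNReal.orderIsoRpow p hp0).map_iSup _
    · exact fun n => (hM.min aemeasurable_const).pow_const p
    · refine ae_of_all _ fun x a b hab => ?_
      dsimp only
      gcongr
  rw [hlim]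
  exact iSup_le hn

/-- Young's inequality for the conjugate exponents 1 + 1/n and n + 1, from comparing N with c
a^(1/n). The free parameter c serves to make the moment term absorbable. -/
theorem mul_le_rpow_add_pow_div (a N c : ℝ≥0∞) (hc0 : c ≠ 0) (hc : c ≠ ∞) (n : ℕ) (hn : n ≠ 0) :
    a * N ≤ c * a ^ (1 + (n : ℝ)⁻¹) + N ^ (n + 1) / c ^ n := by
  have hn' : (0 : ℝ) < (n : ℝ)⁻¹ := by positivity
  rcases le_total N (c * a ^ (n : ℝ)⁻¹) with h | h
  · calc a * N ≤ a * (c * a ^ (n : ℝ)⁻¹) := by gcongr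
      _ = c * a ^ (1 + (n : ℝ)⁻¹) := by
        rw [ENNReal.rpow_add_of_nonneg _ _ zero_le_one hn'.le, ENNReal.rpow_one]
        ring
      _ ≤ _ := le_self_add
  · have h1 : a ≤ (N / c) ^ n := by
      have h2 : a ^ (n : ℝ)⁻¹ ≤ N / c := by
        rw [ENNReal.le_div_iff_mul_le (Or.inl hc0) (Or.inl hc), mul_comm]
        exact h
      calc a = (a ^ (n : ℝ)⁻¹) ^ n := by
            rw [← ENNReal.rpow_mul_natCast, inv_mul_cancel₀ (by exact_mod_cast hn),
              ENNReal.rpow_one]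
        _ ≤ _ := by gcongr
    calc a * N ≤ (N / c) ^ n * N := by gcongr
      _ = N ^ (n + 1) / c ^ n := by
        rw [div_eq_mul_inv, mul_pow, div_eq_mul_inv, ENNReal.inv_pow]
        ring
      _ ≤ _ := le_add_self

/-- The Young inequality for the pair `a log⁺ a` and `exp b`. -/
theorem ofReal_mul_le_posLog_add_exp (a : ℝ) (ha : 0 ≤ a) (b : ℝ≥0∞) :
    ENNReal.ofReal a * b ≤ ENNReal.ofReal (a * Real.posLog a) +
      ∑' j : ℕ, b ^ j / (j.factorial : ℝ≥0∞) := by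
  rcases eq_or_ne b ∞ with rfl | hb
  · have : ∑' j : ℕ, (∞ : ℝ≥0∞) ^ j / (j.factorial : ℝ≥0∞) = ∞ := by
      refine ENNReal.tsum_eq_top_of_eq_top ⟨1, ?_⟩
      simp
    simp [this]
  · lift b to ℝ≥0 using hb
    have h1 : ∑' j : ℕ, (b : ℝ≥0∞) ^ j / (j.factorial : ℝ≥0∞) = ENNReal.ofReal (Real.exp b) := by
      rw [Real.exp_eq_exp_ℝ, NormedSpace.exp_eq_tsum_div]
      rw [ENNReal.ofReal_tsum_of_nonneg (fun n => by positivity)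
        (NormedSpace.expSeries_div_summable (b : ℝ))]
      refine tsum_congr fun n => ?_
      rw [ENNReal.ofReal_div_of_pos (by positivity), ENNReal.ofReal_pow (by positivity),
        ENNReal.ofReal_coe_nnreal, ENNReal.ofReal_natCast]
    rw [h1, ← ENNReal.ofReal_add (mul_nonneg ha Real.posLog_nonneg) (Real.exp_pos _).le]
    rw [← ENNReal.ofReal_coe_nnreal (p := b), ← ENNReal.ofReal_mul ha]
    refine ENNReal.ofReal_le_ofReal ?_
    rcases ha.eq_or_lt with rfl | ha
    · simp [(Real.exp_pos _).le]
    · have h2 : Real.log a ≤ Real.posLog a := le_max_right _ _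
      -- Multiplied by a, this reads ab ≤ a log a - a + e^b.
      have h3 := Real.add_one_le_exp ((b : ℝ) - Real.log a)
      rw [Real.exp_sub, Real.exp_log ha, le_div_iff₀ ha] at h3
      nlinarith

end Interpolation

/-! ### Maximal inequalities for families with bounded overlap -/

section MaximalInequality

variable {Y : Type*}

theorem subsetAverage_le {f : Y → ℝ≥0∞} {U : Y → Set Y} {p : Y} {c : ℝ≥0∞}
    (h : ∀ q ∈ U p, f q ≤ c) : subsetAverage f U p ≤ c := by
  refine ENNReal.div_le_of_le_mul ?_
  rw [tsum_subtype]
  exact tsum_indicator_mul_le_setCard _ _ _ h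

theorem subsetAverage_le_add {f a : Y → ℝ≥0∞} {c : ℝ≥0∞} (h : ∀ q, f q ≤ a q + c)
    (U : Y → Set Y) (p : Y) : subsetAverage f U p ≤ subsetAverage a U p + c := by
  have h1 : subsetAverage f U p ≤ subsetAverage a U p + subsetAverage (fun _ => c) U p := by
    rw [subsetAverage, subsetAverage, subsetAverage, ← ENNReal.add_div, ← ENNReal.tsum_add]
    gcongr
    exact h _
  exact h1.trans (by gcongr; exact subsetAverage_le fun _ _ => le_rfl)

theorem subsetAverage_const_mul (c : ℝ≥0∞) (f : Y → ℝ≥0∞) (U : Y → Set Y) (p : Y) :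
    subsetAverage (fun q => c * f q) U p = c * subsetAverage f U p := by
  rw [subsetAverage, subsetAverage, ENNReal.tsum_mul_left, mul_div_assoc]

/-- The subset function obtained from a family by a choice of indices on a set. -/
def selectedFamily {S : Type*} (F : S → Y → Set Y) (E : Set Y) (r : Y → S) (p : Y) : Set Y :=
  {q | p ∈ E ∧ q ∈ F (r p) p}

variable {ι : Type*} [MeasurableSpace Y] {𝕀 : Set ℝ}

/-- A Borel family of subset functions of `R`, almost everywhere finite, such that all choices of
indices have bounded overlap. -/
structure IsMaximalFamily (m : Measure Y) (R : Y → Y → Prop) (F : 𝕀 → Y → Set Y) (C : ℝ≥0∞) :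
    Prop where
  rel : ∀ s p q, q ∈ F s p → R p q
  classMeasurableSet : ClassMeasurableSet m R F
  exists_good : ∃ G : Set Y, (∀ᵐ p ∂m, p ∈ G) ∧ (∀ p ∈ G, ∀ s, (F s p).Finite) ∧
    ∀ E ⊆ G, ∀ r : Y → 𝕀, BoundedOverlap (selectedFamily F E r) (fun p => (r p : ℝ)) C

variable {m : Measure Y} {R : Y → Y → Prop} {A : ι → Set Y} {φ : ι → Y → Y} [Countable ι]
  {F : 𝕀 → Y → Set Y} {C : ℝ≥0}

/-- Measurable choice of an index at which the average exceeds a given function. -/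
theorem IsMaximalFamily.exists_selection [StandardBorelSpace Y] [StandardBorelSpace 𝕀]
    [Nonempty 𝕀] [IsFiniteMeasure m] (hF : IsMaximalFamily m R F C) (hR : OrbitChart m R A φ)
    {f : Y → ℝ≥0∞} (hf : AEMeasurable f m) {h : Y → ℝ≥0∞} (hh : Measurable h) :
    ∃ (E : Set Y) (r : Y → 𝕀), MeasurableSet E ∧ (∀ p q, q ∈ selectedFamily F E r p → R p q) ∧
      (ClassMeasurableSet m R fun _ : Unit => selectedFamily F E r) ∧
      (∀ k : ℕ, ∫⁻ q, totalPacking (selectedFamily F E r) q ^ (k + 1) ∂m ≤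
        ((k + 1).factorial : ℝ≥0∞) * C ^ k * m E) ∧
      (∀ p ∈ E, h p < subsetAverage f (F (r p)) p) ∧
      (∀ p ∈ E, ∀ a : Y → ℝ≥0∞,
        subsetAverage a (selectedFamily F E r) p = subsetAverage a (F (r p)) p) ∧
      ∀ᵐ p ∂m, h p < (⨆ s, subsetAverage f (F s) p) → p ∈ E := by
  obtain ⟨H, hH, hHF⟩ := hR.exists_measurable_subsetAverage hF.rel hF.classMeasurableSet hf
  obtain ⟨G, hG, hGfin, hGC⟩ := hF.exists_good
  -- Discarding a Borel null set makes the Borel version H correct for all indices at every point of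
  -- E, and puts E inside the good set.
  let N := toMeasurable m {p | ¬ (p ∈ G ∧ ∀ s, subsetAverage f (F s) p = H (s, p))}
  have hN : m N = 0 := by
    rw [measure_toMeasurable]
    exact hG.and hHF
  have hNm : MeasurableSet N := measurableSet_toMeasurable _ _
  have hN' : ∀ p ∉ N, p ∈ G ∧ ∀ s, subsetAverage f (F s) p = H (s, p) := by
    intro p hp
    by_contra hcon
    exact hp (subset_toMeasurable _ _ hcon)
  obtain ⟨D, r, hD, hr, hDr, hae⟩ := exists_measurable_section (S := 𝕀) m
    (A := {z | h z.1 < H (z.2, z.1)})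
    (measurableSet_lt (hh.comp measurable_fst) (hH.comp measurable_swap))
  have hE : MeasurableSet (D \ N) := hD.diff hNm
  have hEG : D \ N ⊆ G := fun p hp => (hN' p hp.2).1
  have hrel : ∀ p q, q ∈ selectedFamily F (D \ N) r p → R p q := fun p q hq =>
    hF.rel _ p q hq.2
  have hmeas : ClassMeasurableSet m R fun _ : Unit => selectedFamily F (D \ N) r := by
    obtain ⟨V, hV, hFV⟩ := hF.classMeasurableSet
    refine ⟨{z | z.2.1 ∈ D \ N ∧ (r z.2.1, z.2.1, z.2.2) ∈ V}, MeasurableSet.inter ?_ ?_, ?_⟩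
    · exact (measurable_fst.comp measurable_snd) hE
    · exact ((hr.comp (measurable_fst.comp measurable_snd)).prodMk
        ((measurable_fst.comp measurable_snd).prodMk (measurable_snd.comp measurable_snd))) hV
    · filter_upwards [hFV] with p hp q hq _
      simp only [selectedFamily, Set.mem_ofPred_eq, hp q hq (r p)]
  refine ⟨D \ N, r, hE, hrel, hmeas, ?_, ?_, ?_, ?_⟩
  · refine hR.lintegral_totalPacking_pow_le hrel hmeas (ρ := fun p => (r p : ℝ))
      (measurable_subtype_coe.comp hr) (fun p => ?_) (hGC _ hEG r) hE fun p ⟨q, hq⟩ => hq.1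
    by_cases hp : p ∈ D \ N
    · exact (hGfin p (hEG hp) (r p)).subset fun q hq => hq.2
    · convert! Set.finite_empty
      ext q
      simp [selectedFamily, hp]
  · intro p hp
    rw [(hN' p hp.2).2]
    exact hDr p hp.1
  · intro p hp a
    have : selectedFamily F (D \ N) r p = F (r p) p := by
      ext q
      simp only [selectedFamily, Set.mem_ofPred_eq, hp, true_and]
    rw [subsetAverage, subsetAverage, tsum_subtype, tsum_subtype, this]
  · filter_upwards [hae, measure_eq_zero_iff_ae_notMem.1 hN] with p hp hpN hlt
    obtain ⟨s, hs⟩ := lt_iSup_iff.1 hlt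
    rw [(hN' p hpN).2 s] at hs
    exact ⟨hp s hs, hpN⟩

theorem IsMaximalFamily.aemeasurable_iSup [StandardBorelSpace Y] [StandardBorelSpace 𝕀]
    [IsFiniteMeasure m] (hF : IsMaximalFamily m R F C) (hR : OrbitChart m R A φ)
    {f : Y → ℝ≥0∞} (hf : AEMeasurable f m) :
    AEMeasurable (fun p => ⨆ s, subsetAverage f (F s) p) m := by
  obtain ⟨H, hH, hHF⟩ := hR.exists_measurable_subsetAverage hF.rel hF.classMeasurableSet hf
  refine (aemeasurable_iSup_prod m (hH.comp measurable_swap)).congr ?_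
  filter_upwards [hHF] with p hp
  simp only [Function.comp, Prod.swap, hp]

/-- The constant in the weak-type inequality of exponent `1 + 1/n`. -/
noncomputable def weakConst (C : ℝ≥0) (n : ℕ) : ℝ≥0 :=
  4 * (4 * ((n + 1).factorial * C ^ n))

/-- The weak-type maximal inequality of exponent `1 + 1/n`, at height one. -/
theorem IsMaximalFamily.measure_one_lt_le [StandardBorelSpace Y] [StandardBorelSpace 𝕀]
    [Nonempty 𝕀] [IsFiniteMeasure m] (hF : IsMaximalFamily m R F C) (hR : OrbitChart m R A φ)
    (hC : 1 ≤ C) {f : Y → ℝ≥0∞} (hf : AEMeasurable f m) {n : ℕ} (hn : n ≠ 0) :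
    m {p | 1 < ⨆ s, subsetAverage f (F s) p} ≤
      weakConst C n * ∫⁻ p in {p | 1 / 2 < f p}, f p ^ (1 + (n : ℝ)⁻¹) ∂m := by
  obtain ⟨E, r, hE, hrel, hmeas, hmom, hlt, havg, hae⟩ :=
    hF.exists_selection hR hf (measurable_const (a := (1 : ℝ≥0∞)))
  refine (measure_mono_ae (t := E) hae).trans ?_
  have hset : NullMeasurableSet {p | 1 / 2 < f p} m := nullMeasurableSet_lt aemeasurable_const hf
  -- The part of f below 1/2 adds at most 1/2 to any average, so an average of f above 1 leaves at
  -- least 1/2 for the truncation a.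
  set a : Y → ℝ≥0∞ := {p | 1 / 2 < f p}.indicator f with ha
  have ham : AEMeasurable a m := hf.indicator₀ hset
  have hfa : ∀ q, f q ≤ a q + 1 / 2 := by
    intro q
    by_cases hq : 1 / 2 < f q
    · rw [ha, Set.indicator_of_mem (show q ∈ {p | 1 / 2 < f p} from hq)]
      exact le_self_add
    · exact (not_lt.1 hq).trans le_add_self
  set K : ℝ≥0 := (n + 1).factorial * C ^ n with hK
  have hK1 : 1 ≤ K := by
    have h1 : (1 : ℝ≥0) ≤ (n + 1).factorial := by
      exact_mod_cast (n + 1).factorial_pos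
    exact one_le_mul h1 (one_le_pow₀ hC)
  have hK0 : (K : ℝ≥0∞) ≠ 0 := by
    have : K ≠ 0 := (zero_lt_one.trans_le hK1).ne'
    exact_mod_cast this
  have h1 : m E * 2⁻¹ ≤ ∫⁻ q, a q * totalPacking (selectedFamily F E r) q ∂m := by
    rw [← hR.lintegral_average_eq hrel hmeas ham, mul_comm, ← setLIntegral_const]
    refine (setLIntegral_mono' hE fun p hp => ?_).trans (setLIntegral_le_lintegral _ _)
    rw [havg p hp]
    have h2 := (hlt p hp).trans_le (subsetAverage_le_add hfa (F (r p)) p)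
    by_contra! hcon
    refine absurd h2 (not_lt.2 ?_)
    calc _ ≤ (2⁻¹ : ℝ≥0∞) + 1 / 2 := by gcongr
      _ = 1 := by rw [one_div, ENNReal.inv_two_add_inv_two]
  -- Young's inequality is used with c = 4K, where K m(E) bounds the moment of order n+1. As c ≥ 1,
  -- dividing by c^n leaves at most m(E)/4, to be absorbed into the lower bound m(E)/2.
  have h2 : ∫⁻ q, totalPacking (selectedFamily F E r) q ^ (n + 1) / (4 * K : ℝ≥0∞) ^ n ∂m ≤
      m E * 4⁻¹ := by
    simp only [div_eq_mul_inv]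
    rw [lintegral_mul_const'' _ ((hR.aemeasurable_totalPacking hrel hmeas).pow_const _)]
    calc _ ≤ ((K : ℝ≥0∞) * m E) * (4 * K : ℝ≥0∞)⁻¹ := by
          gcongr
          · refine (hmom n).trans (le_of_eq ?_)
            rw [hK]
            push_cast
            rfl
          · refine le_self_pow ?_ hn
            exact_mod_cast one_le_mul (by norm_num : (1 : ℝ≥0) ≤ 4) hK1
      _ = _ := by
          rw [ENNReal.mul_inv (Or.inl (by norm_num)) (Or.inl (by norm_num)), mul_comm (K : ℝ≥0∞),
            mul_assoc, mul_comm _ (K : ℝ≥0∞)⁻¹, ← mul_assoc (K : ℝ≥0∞),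
            ENNReal.mul_inv_cancel hK0 ENNReal.coe_ne_top, one_mul]
  have h3 : ∫⁻ q, a q * totalPacking (selectedFamily F E r) q ∂m ≤
      4 * K * ∫⁻ p in {p | 1 / 2 < f p}, f p ^ (1 + (n : ℝ)⁻¹) ∂m + m E * 4⁻¹ := by
    calc _ ≤ ∫⁻ q, (4 * K * a q ^ (1 + (n : ℝ)⁻¹) +
          totalPacking (selectedFamily F E r) q ^ (n + 1) / (4 * K : ℝ≥0∞) ^ n) ∂m := by
          refine lintegral_mono fun q => mul_le_rpow_add_pow_div _ _ _ ?_ ?_ n hn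
          · exact mul_ne_zero (by norm_num) hK0
          · finiteness
      _ = 4 * K * ∫⁻ q, a q ^ (1 + (n : ℝ)⁻¹) ∂m +
          ∫⁻ q, totalPacking (selectedFamily F E r) q ^ (n + 1) / (4 * K : ℝ≥0∞) ^ n ∂m := by
          rw [lintegral_add_left' ((ham.pow_const _).const_mul _),
            lintegral_const_mul' _ _ (by finiteness)]
      _ ≤ _ := by
          refine add_le_add (mul_le_mul_right ?_ _) h2
          rw [← lintegral_indicator₀ hset]
          refine le_of_eq (lintegral_congr fun q => ?_)
          by_cases hq : 1 / 2 < f q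
          · have hq' : q ∈ {p | 1 / 2 < f p} := hq
            rw [ha, Set.indicator_of_mem hq', Set.indicator_of_mem hq']
          · have hq' : q ∉ {p | 1 / 2 < f p} := hq
            rw [ha, Set.indicator_of_notMem hq', Set.indicator_of_notMem hq',
              ENNReal.zero_rpow_of_pos (by positivity)]
  have h4 : m E * 4⁻¹ + m E * 4⁻¹ ≤
      4 * K * ∫⁻ p in {p | 1 / 2 < f p}, f p ^ (1 + (n : ℝ)⁻¹) ∂m + m E * 4⁻¹ := by
    refine le_trans (le_of_eq ?_) (h1.trans h3)
    · rw [← mul_add]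
      congr 1
      rw [← two_mul, show (4 : ℝ≥0∞) = 2 * 2 by norm_num,
        ENNReal.mul_inv (Or.inl (by norm_num)) (Or.inl (by norm_num)), ← mul_assoc,
        ENNReal.mul_inv_cancel (by norm_num) (by norm_num), one_mul]
  have h5 := (ENNReal.add_le_add_iff_right (by finiteness)).1 h4
  calc m E = 4 * (m E * 4⁻¹) := by
        rw [mul_comm (m E), ← mul_assoc, ENNReal.mul_inv_cancel (by norm_num) (by norm_num),
          one_mul]
    _ ≤ 4 * (4 * K * ∫⁻ p in {p | 1 / 2 < f p}, f p ^ (1 + (n : ℝ)⁻¹) ∂m) := by gcongr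
    _ = _ := by
        rw [weakConst, ← hK]
        push_cast
        ring

/-- The constant in the strong-type inequality of exponent `p`. -/
noncomputable def strongConst (C : ℝ≥0) (p : ℝ) : ℝ≥0∞ :=
  weakConst C (⌊(p - 1)⁻¹⌋₊ + 1) * (ENNReal.ofReal p *
    (ENNReal.ofReal (p - 1 - ((⌊(p - 1)⁻¹⌋₊ + 1 : ℕ) : ℝ)⁻¹))⁻¹ *
      ENNReal.ofReal (2 ^ (p - 1 - ((⌊(p - 1)⁻¹⌋₊ + 1 : ℕ) : ℝ)⁻¹)))

/-- This choice of n places the weak-type exponent 1 + 1/n strictly below p, as interpolation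
requires. -/
theorem inv_floor_add_one_lt {p : ℝ} (hp : 1 < p) :
    ((⌊(p - 1)⁻¹⌋₊ + 1 : ℕ) : ℝ)⁻¹ < p - 1 := by
  have h1 : (p - 1)⁻¹ < (⌊(p - 1)⁻¹⌋₊ + 1 : ℕ) := by
    push_cast
    exact Nat.lt_floor_add_one _
  exact inv_lt_of_inv_lt₀ (by linarith) h1

theorem strongConst_ne_top (C : ℝ≥0) {p : ℝ} (hp : 1 < p) : strongConst C p ≠ ∞ := by
  have h := inv_floor_add_one_lt hp
  refine ENNReal.mul_ne_top ENNReal.coe_ne_top (ENNReal.mul_ne_top (ENNReal.mul_ne_top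
    ENNReal.ofReal_ne_top ?_) ENNReal.ofReal_ne_top)
  rw [ENNReal.inv_ne_top]
  exact (ENNReal.ofReal_pos.2 (by linarith)).ne'

/-- The strong-type maximal inequality. -/
theorem IsMaximalFamily.lintegral_rpow_le [StandardBorelSpace Y] [StandardBorelSpace 𝕀]
    [Nonempty 𝕀] [IsFiniteMeasure m] (hF : IsMaximalFamily m R F C) (hR : OrbitChart m R A φ)
    (hC : 1 ≤ C) {f : Y → ℝ} (hf : AEMeasurable f m) {p : ℝ} (hp : 1 < p) :
    ∫⁻ x, (⨆ s, subsetAverage (fun q => ‖f q‖ₑ) (F s) x) ^ p ∂m ≤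
      strongConst C p * ∫⁻ x, ‖f x‖ₑ ^ p ∂m := by
  have h := inv_floor_add_one_lt hp
  set n := ⌊(p - 1)⁻¹⌋₊ + 1 with hn
  have h1 := lintegral_rpow_le_of_weak_type (f := fun x => |f x|) (p := p) (s := (n : ℝ)⁻¹)
    (D := weakConst C n)
    (M := fun x => ⨆ s, subsetAverage (fun q => ‖f q‖ₑ) (F s) x) hf.abs
    (fun x => abs_nonneg _) (hF.aemeasurable_iSup hR hf.enorm) (by positivity)
    (by linarith) ?_
  · refine h1.trans (le_of_eq ?_)
    rw [strongConst]
    congr 1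
    refine lintegral_congr fun x => ?_
    rw [← ENNReal.ofReal_rpow_of_nonneg (abs_nonneg _) (by linarith), ← Real.enorm_eq_ofReal_abs]
  · intro t ht
    have ht0 : ENNReal.ofReal t ≠ 0 := (ENNReal.ofReal_pos.2 ht).ne'
    -- Homogeneity reduces height t to height one.
    have h2 := hF.measure_one_lt_le hR hC (f := fun q => (ENNReal.ofReal t)⁻¹ * ‖f q‖ₑ)
      (hf.enorm.const_mul _) (n := n) (by omega)
    simp only [subsetAverage_const_mul, ← ENNReal.mul_iSup] at h2
    have h3 : ∀ x, (ENNReal.ofReal t)⁻¹ * ‖f x‖ₑ = ENNReal.ofReal (|f x| / t) := by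
      intro x
      rw [ENNReal.ofReal_div_of_pos ht, ← Real.enorm_eq_ofReal_abs, mul_comm, div_eq_mul_inv]
    simp only [h3] at h2
    have e1 : {x | ENNReal.ofReal t < ⨆ s, subsetAverage (fun q => ‖f q‖ₑ) (F s) x} =
        {x | 1 < (ENNReal.ofReal t)⁻¹ * ⨆ s, subsetAverage (fun q => ‖f q‖ₑ) (F s) x} := by
      ext x
      simp only [Set.mem_ofPred_eq]
      rw [mul_comm, ← div_eq_mul_inv, ENNReal.lt_div_iff_mul_lt (Or.inl ht0)
        (Or.inl ENNReal.ofReal_ne_top), one_mul]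
    have e2 : {x | t < 2 * |f x|} = {x | 1 / 2 < ENNReal.ofReal (|f x| / t)} := by
      ext x
      simp only [Set.mem_ofPred_eq]
      rw [show (1 / 2 : ℝ≥0∞) = ENNReal.ofReal (1 / 2) by
        rw [ENNReal.ofReal_div_of_pos (by norm_num)]; simp]
      rw [ENNReal.ofReal_lt_ofReal_iff_of_nonneg (by norm_num), lt_div_iff₀ ht]
      constructor <;> intro h <;> linarith
    rw [e1, e2]
    refine h2.trans_eq ?_
    congr 1
    refine lintegral_congr fun x => ?_
    rw [ENNReal.ofReal_rpow_of_nonneg (by positivity) (by positivity)]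

/-- The maximal inequality from `L log L` to `L^1`. -/
theorem IsMaximalFamily.lintegral_le_of_posLog [StandardBorelSpace Y] [StandardBorelSpace 𝕀]
    [Nonempty 𝕀] [IsProbabilityMeasure m] (hF : IsMaximalFamily m R F C)
    (hR : OrbitChart m R A φ) (hC : 1 ≤ C) {f : Y → ℝ} (hf : AEMeasurable f m) {k : ℝ≥0}
    (hk : 0 < k) (hfk : ∫⁻ y, ENNReal.ofReal (|f y| / k * Real.posLog (|f y| / k)) ∂m ≤ 1) :
    ∫⁻ x, (⨆ s, subsetAverage (fun q => ‖f q‖ₑ) (F s) x) ∂m ≤ 12 * C * k := by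
  have hMm := hF.aemeasurable_iSup hR hf.enorm
  set M : Y → ℝ≥0∞ := fun x => ⨆ s, subsetAverage (fun q => ‖f q‖ₑ) (F s) x with hM
  have hC0 : (C : ℝ≥0∞) ≠ 0 := by
    have : C ≠ 0 := (zero_lt_one.trans_le hC).ne'
    exact_mod_cast this
  have hC1 : (1 : ℝ≥0∞) ≤ C := by exact_mod_cast hC
  have hk0 : (k : ℝ≥0∞) ≠ 0 := by exact_mod_cast hk.ne'
  have hn : ∀ n : ℕ, ∫⁻ x, min (M x / 2) n ∂m ≤ 6 * C * k := by
    intro n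
    -- The height must lie strictly below M wherever M ≠ 0. Halving ensures this where M is finite,
    -- the cutoff n where M = ∞.
    obtain ⟨E, r, hE, hrel, hmeas, hmom, hlt, havg, hae⟩ := hF.exists_selection hR hf.enorm
      (h := fun x => min (hMm.mk M x / 2) n) (by have := hMm.measurable_mk; fun_prop)
    set N := totalPacking (selectedFamily F E r) with hN
    have hNm : AEMeasurable N m := hR.aemeasurable_totalPacking hrel hmeas
    have h1 : ∫⁻ x, min (M x / 2) n ∂m ≤ ∫⁻ q, ‖f q‖ₑ * N q ∂m := by
      rw [← hR.lintegral_average_eq hrel hmeas hf.enorm]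
      refine lintegral_mono_ae ?_
      filter_upwards [hae, hMm.ae_eq_mk] with x hx hxM
      rcases eq_or_ne (M x) 0 with h0 | h0
      · simp [h0]
      · have hlt' : min (M x / 2) n < M x := by
          rcases eq_or_ne (M x) ∞ with htop | htop
          · rw [htop]
            exact (min_le_right _ _).trans_lt (ENNReal.natCast_lt_top n)
          · exact (min_le_left _ _).trans_lt (ENNReal.half_lt_self h0 htop)
        rw [hxM] at hlt' ⊢
        have hxE := hx (hlt'.trans_eq hxM.symm)
        rw [havg x hxE]
        exact (hlt x hxE).le
    -- Young's inequality for |f|/k and N/(2C). The scale 2C brings the j-th term of the exponential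
    -- series down to 2^(-j), with sum 2, whence 2Ck(1 + 2) = 6Ck, doubled at the end because of
    -- M/2.
    have h2 : ∀ q, ‖f q‖ₑ * N q ≤ 2 * C * k *
        (ENNReal.ofReal (|f q| / k * Real.posLog (|f q| / k)) +
          ∑' j : ℕ, (N q / (2 * C)) ^ j / (j.factorial : ℝ≥0∞)) := by
      intro q
      refine le_trans (le_of_eq ?_) (mul_le_mul_right
        (ofReal_mul_le_posLog_add_exp (|f q| / k) (by positivity) (N q / (2 * C))) _)
      rw [ENNReal.ofReal_div_of_pos (by exact_mod_cast hk), ← Real.enorm_eq_ofReal_abs,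
        ENNReal.ofReal_coe_nnreal]
      have e1 : (k : ℝ≥0∞) * (‖f q‖ₑ / k) = ‖f q‖ₑ := ENNReal.mul_div_cancel hk0 (by finiteness)
      have e2 : 2 * (C : ℝ≥0∞) * (N q / (2 * C)) = N q :=
        ENNReal.mul_div_cancel (mul_ne_zero (by norm_num) hC0) (by finiteness)
      calc _ = (k * (‖f q‖ₑ / k)) * (2 * (C : ℝ≥0∞) * (N q / (2 * C))) := by rw [e1, e2]
        _ = _ := by ring
    have h3 : ∀ j : ℕ, ∫⁻ q, (N q / (2 * C)) ^ j / (j.factorial : ℝ≥0∞) ∂m ≤ 2⁻¹ ^ j := by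
      intro j
      rcases j with _ | i
      · simp
      · have hfac : ((i + 1).factorial : ℝ≥0∞) ≠ 0 := by exact_mod_cast Nat.factorial_ne_zero _
        have hpow : (C : ℝ≥0∞) ^ (i + 1) ≠ 0 := pow_ne_zero _ hC0
        simp only [div_eq_mul_inv, mul_pow]
        rw [lintegral_mul_const' _ _ (by simpa using hfac),
          lintegral_mul_const'' _ (hNm.pow_const _)]
        calc _ ≤ ((i + 1).factorial * C ^ (i + 1) * 1 : ℝ≥0∞) * ((2 * C)⁻¹ : ℝ≥0∞) ^ (i + 1) *
              ((i + 1).factorial : ℝ≥0∞)⁻¹ := by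
              gcongr
              refine (hmom i).trans ?_
              gcongr
              · omega
              · exact prob_le_one
          _ = ((i + 1).factorial * ((i + 1).factorial : ℝ≥0∞)⁻¹) *
              ((C : ℝ≥0∞) ^ (i + 1) * ((C : ℝ≥0∞) ^ (i + 1))⁻¹) * 2⁻¹ ^ (i + 1) := by
              rw [ENNReal.mul_inv (Or.inl (by norm_num)) (Or.inl (by norm_num)), mul_pow,
                ← ENNReal.inv_pow (a := (C : ℝ≥0∞))]
              ring
          _ = _ := by
              rw [ENNReal.mul_inv_cancel hfac (by finiteness),
                ENNReal.mul_inv_cancel hpow (by finiteness), one_mul, one_mul]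
    have h4 : ∫⁻ q, ∑' j : ℕ, (N q / (2 * C)) ^ j / (j.factorial : ℝ≥0∞) ∂m ≤ 2 := by
      rw [lintegral_tsum fun j => ((hNm.div_const _).pow_const _).div_const _]
      refine (ENNReal.tsum_le_tsum h3).trans (le_of_eq ?_)
      rw [ENNReal.tsum_geometric, ENNReal.one_sub_inv_two, inv_inv]
    calc _ ≤ ∫⁻ q, 2 * C * k * (ENNReal.ofReal (|f q| / k * Real.posLog (|f q| / k)) +
          ∑' j : ℕ, (N q / (2 * C)) ^ j / (j.factorial : ℝ≥0∞)) ∂m :=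
          h1.trans (lintegral_mono h2)
      _ = 2 * C * k * (∫⁻ q, ENNReal.ofReal (|f q| / k * Real.posLog (|f q| / k)) ∂m +
          ∫⁻ q, ∑' j : ℕ, (N q / (2 * C)) ^ j / (j.factorial : ℝ≥0∞) ∂m) := by
          rw [lintegral_const_mul' _ _ (by finiteness), lintegral_add_left']
          refine AEMeasurable.ennreal_ofReal ?_
          have h5 : AEMeasurable (fun q => |f q| / k) m := hf.abs.div_const _
          have h6 : Measurable Real.posLog := measurable_const.max Real.measurable_log
          exact h5.mul (h6.comp_aemeasurable h5)
      _ ≤ 2 * C * k * (1 + 2) := by gcongr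
      _ = 6 * C * k := by ring
  have hlim : ∫⁻ x, M x / 2 ∂m = ⨆ n : ℕ, ∫⁻ x, min (M x / 2) n ∂m := by
    rw [← lintegral_iSup']
    · refine lintegral_congr fun x => ?_
      rw [← inf_iSup_eq, ENNReal.iSup_natCast, inf_top_eq]
    · exact fun n => (hMm.div_const _).min aemeasurable_const
    · refine ae_of_all _ fun x a b hab => ?_
      dsimp only
      gcongr
  have h6 : ∫⁻ x, M x / 2 ∂m ≤ 6 * C * k := hlim.trans_le (iSup_le hn)
  simp only [div_eq_mul_inv] at h6
  rw [lintegral_mul_const'' _ hMm, ← div_eq_mul_inv,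
    ENNReal.div_le_iff_le_mul (Or.inl (by norm_num)) (Or.inl (by norm_num))] at h6
  calc _ ≤ _ := h6
    _ = _ := by ring

/-- The maximal inequality in `L^∞`. -/
theorem IsMaximalFamily.ae_iSup_le (hF : IsMaximalFamily m R F C) (hR : OrbitChart m R A φ)
    {f : Y → ℝ≥0∞} {c : ℝ≥0∞} (hc : ∀ᵐ p ∂m, f p ≤ c) :
    ∀ᵐ p ∂m, ⨆ s, subsetAverage f (F s) p ≤ c := by
  filter_upwards [hR.ae_class hc] with p hp
  exact iSup_le fun s => subsetAverage_le fun q hq => hp q (hF.rel s p q hq)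

end MaximalInequality

/-! ### The orbit relation of the Maharam extension -/

section Cocycle

variable {Γ B : Type*} [Group Γ] [MulAction Γ B] [MeasurableSpace B]

theorem rnCocycle_one (ν : Measure B) (b : B) : rnCocycle ν (1 : Γ) b = 0 := by
  have := rnCocycle_mul ν (1 : Γ) 1 b
  simpa using this

theorem rnCocycle_inv_smul (ν : Measure B) (g : Γ) (b : B) :
    rnCocycle ν g⁻¹ (g • b) = -rnCocycle ν g b := by
  have := rnCocycle_mul ν g⁻¹ g b
  rw [inv_mul_cancel, rnCocycle_one] at this
  linarith

theorem measurable_logRN (ν : Measure B) (g : Γ) : Measurable (logRN ν g) :=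
  (Real.measurable_log.comp (Measure.measurable_rnDeriv _ _).ennreal_toReal).neg

theorem measurableSet_cocycleSet [Countable Γ] [MeasurableConstSMul Γ B] (ν : Measure B) :
    MeasurableSet (cocycleSet Γ ν) := by
  have : cocycleSet Γ ν = ⋂ g : Γ, ⋂ h : Γ, ⋂ k : Γ,
      {b | logRN ν (g * h) (k • b) = logRN ν g (h • k • b) + logRN ν h (k • b)} := by
    ext b
    simp [cocycleSet]
  rw [this]
  refine MeasurableSet.iInter fun g => MeasurableSet.iInter fun h => MeasurableSet.iInter fun k =>
    measurableSet_eq_fun ((measurable_logRN ν _).comp (measurable_const_smul k)) ?_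
  exact ((measurable_logRN ν g).comp ((measurable_const_smul h).comp
    (measurable_const_smul k))).add ((measurable_logRN ν h).comp (measurable_const_smul k))

theorem measurable_rnCocycle [Countable Γ] [MeasurableConstSMul Γ B] (ν : Measure B) (g : Γ) :
    Measurable (rnCocycle ν g) := by
  classical
  exact Measurable.ite (measurableSet_cocycleSet ν) (measurable_logRN ν g) measurable_const

/-- Change of variables for a nonsingular transformation, in terms of the cocycle. -/
theorem lintegral_exp_neg_rnCocycle_mul [Countable Γ] [MeasurableConstSMul Γ B] (ν : Measure B)
    [IsProbabilityMeasure ν]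
    (hns : ∀ g : Γ, Measure.QuasiMeasurePreserving (fun b : B => g • b) ν ν) (g : Γ)
    {h : B → ℝ≥0∞} (hh : Measurable h) :
    ∫⁻ b, ENNReal.ofReal (Real.exp (-rnCocycle ν g b)) * h (g • b) ∂ν = ∫⁻ b, h b ∂ν := by
  have hm : ∀ k : Γ, Measurable (fun b : B => k • b) := fun k => measurable_const_smul k
  have hac : ν.map (fun b : B => g⁻¹ • b) ≪ ν := (hns g⁻¹).absolutelyContinuous
  have hac' : ν ≪ ν.map (fun b : B => g⁻¹ • b) := by
    have h1 := (hns g).absolutelyContinuous.map (hm g⁻¹)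
    rw [Measure.map_map (hm g⁻¹) (hm g)] at h1
    have : (fun b : B => g⁻¹ • b) ∘ (fun b : B => g • b) = id := by
      funext b; simp
    rwa [this, Measure.map_id] at h1
  have : IsProbabilityMeasure (ν.map (fun b : B => g⁻¹ • b)) :=
    Measure.isProbabilityMeasure_map (hm _).aemeasurable
  -- Equivalence of the two measures makes the density positive and finite almost everywhere, so the
  -- exponential undoes the logarithm.
  have h1 : ∀ᵐ b ∂ν, ENNReal.ofReal (Real.exp (-rnCocycle ν g b)) =
      (ν.map (fun b : B => g⁻¹ • b)).rnDeriv ν b := by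
    filter_upwards [rnCocycle_ae_eq ν hns, Measure.rnDeriv_pos' hac',
      Measure.rnDeriv_lt_top (ν.map (fun b : B => g⁻¹ • b)) ν] with b hb hpos hlt
    rw [hb g, logRN, neg_neg, Real.exp_log (ENNReal.toReal_pos hpos.ne' hlt.ne),
      ENNReal.ofReal_toReal hlt.ne]
  calc _ = ∫⁻ b, (ν.map (fun b : B => g⁻¹ • b)).rnDeriv ν b * h (g • b) ∂ν := by
        refine lintegral_congr_ae ?_
        filter_upwards [h1] with b hb
        rw [hb]
    _ = ∫⁻ b, h (g • b) ∂(ν.map (fun b : B => g⁻¹ • b)) :=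
        lintegral_rnDeriv_mul hac (hh.comp (hm g)).aemeasurable
    _ = _ := by
        rw [lintegral_map (f := fun b => h (g • b)) (hh.comp (hm g)) (hm _)]
        simp

end Cocycle

/-! ### The measure θ_I and translations -/

section Interval

variable {T : ℝ}

/-- Rewriting over the whole line makes translation invariance of Lebesgue measure available. -/
theorem lintegral_thetaI (hT : 0 ≤ T) {h : Set.Icc (0 : ℝ) T → ℝ≥0∞} (hh : Measurable h) :
    ∫⁻ t, h t ∂(thetaI T) = ∫⁻ t, (Set.Icc (0 : ℝ) T).indicator (fun t =>
      ENNReal.ofReal (Real.exp t / (Real.exp T - 1)) * h (Set.projIcc 0 T hT t)) t := by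
  rw [thetaI, lintegral_withDensity_eq_lintegral_mul _ (by fun_prop) hh,
    lintegral_indicator measurableSet_Icc, lebI]
  rw [← lintegral_subtype_comap measurableSet_Icc]
  refine lintegral_congr fun t => ?_
  simp

/-- The density e^t turns a translation by c into the factor e^(-c), which is to match the Jacobian
of g on B. -/
theorem lintegral_thetaI_translate (hT : 0 ≤ T) (c : ℝ) {h : Set.Icc (0 : ℝ) T → ℝ≥0∞}
    (hh : Measurable h) :
    ∫⁻ t, {t : Set.Icc (0 : ℝ) T | (t : ℝ) + c ∈ Set.Icc 0 T}.indicator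
        (fun t => h (Set.projIcc 0 T hT (t + c))) t ∂(thetaI T) =
      ENNReal.ofReal (Real.exp (-c)) * ∫⁻ t, {t : Set.Icc (0 : ℝ) T |
        (t : ℝ) + -c ∈ Set.Icc 0 T}.indicator h t ∂(thetaI T) := by
  have hm : ∀ c : ℝ, MeasurableSet {t : Set.Icc (0 : ℝ) T | (t : ℝ) + c ∈ Set.Icc 0 T} := fun c =>
    (measurable_subtype_coe.add_const c) measurableSet_Icc
  have hp : Measurable fun t : Set.Icc (0 : ℝ) T => h (Set.projIcc 0 T hT (t + c)) :=
    hh.comp (continuous_projIcc.measurable.comp (measurable_subtype_coe.add_const c))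
  rw [lintegral_thetaI hT (hp.indicator (hm c)), lintegral_thetaI hT (hh.indicator (hm (-c))),
    ← lintegral_const_mul' _ _ ENNReal.ofReal_ne_top]
  refine Eq.trans (lintegral_congr fun t => ?_) (lintegral_add_right_eq_self _ c)
  by_cases h1 : t ∈ Set.Icc 0 T
  · by_cases h2 : t + c ∈ Set.Icc 0 T
    · have h3 : Set.projIcc 0 T hT t ∈
          {t : Set.Icc (0 : ℝ) T | (t : ℝ) + c ∈ Set.Icc 0 T} := by
        simpa only [Set.mem_ofPred_eq, Set.projIcc_of_mem hT h1] using h2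
      have h4 : Set.projIcc 0 T hT (t + c) ∈
          {t : Set.Icc (0 : ℝ) T | (t : ℝ) + -c ∈ Set.Icc 0 T} := by
        simpa only [Set.mem_ofPred_eq, Set.projIcc_of_mem hT h2, add_neg_cancel_right] using h1
      rw [Set.indicator_of_mem h1, Set.indicator_of_mem h2, Set.indicator_of_mem h3,
        Set.indicator_of_mem h4, ← mul_assoc, ← ENNReal.ofReal_mul (Real.exp_pos _).le,
        ← mul_div_assoc, ← Real.exp_add]
      simp only [Set.projIcc_of_mem hT h1]
      congr 4
      ring
    · have h3 : Set.projIcc 0 T hT t ∉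
          {t : Set.Icc (0 : ℝ) T | (t : ℝ) + c ∈ Set.Icc 0 T} := by
        simpa only [Set.mem_ofPred_eq, Set.projIcc_of_mem hT h1] using h2
      rw [Set.indicator_of_notMem h2, Set.indicator_of_mem h1, Set.indicator_of_notMem h3]
      simp
  · by_cases h2 : t + c ∈ Set.Icc 0 T
    · have h4 : Set.projIcc 0 T hT (t + c) ∉
          {t : Set.Icc (0 : ℝ) T | (t : ℝ) + -c ∈ Set.Icc 0 T} := by
        simpa only [Set.mem_ofPred_eq, Set.projIcc_of_mem hT h2, add_neg_cancel_right] using h1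
      rw [Set.indicator_of_notMem h1, Set.indicator_of_mem h2, Set.indicator_of_notMem h4]
      simp
    · rw [Set.indicator_of_notMem h1, Set.indicator_of_notMem h2]
      simp

instance lebI.instIsFiniteMeasure : IsFiniteMeasure (lebI T) := by
  refine ⟨?_⟩
  rw [lebI, comap_subtype_coe_apply measurableSet_Icc, Set.image_univ, Subtype.range_coe]
  exact measure_Icc_lt_top

theorem isProbabilityMeasure_thetaI (hT : 0 < T) : IsProbabilityMeasure (thetaI T) := by
  have hT1 : 0 < Real.exp T - 1 := by
    have := Real.add_one_lt_exp hT.ne'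
    linarith
  refine ⟨?_⟩
  have h := lintegral_thetaI hT.le (measurable_const (a := (1 : ℝ≥0∞)))
  rw [lintegral_one, lintegral_indicator measurableSet_Icc] at h
  rw [h]
  simp only [mul_one]
  rw [← ofReal_integral_eq_lintegral_ofReal]
  · rw [integral_Icc_eq_integral_Ioc, ← intervalIntegral.integral_of_le hT.le,
      intervalIntegral.integral_div, integral_exp, Real.exp_zero, div_self hT1.ne',
      ENNReal.ofReal_one]
  · exact (Continuous.integrableOn_Icc (by fun_prop))
  · exact ae_of_all _ fun t => by positivity

end Interval

/-! ### The skew product relation on B × X × [0,T] -/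

section Chart

variable {Γ B X : Type*} [Group Γ] [MulAction Γ B] [MeasurableSpace B] {T : ℝ}

/-- The domain of `g` in `B × X × [0,T]`. -/
def chartDomain (ν : Measure B) (T : ℝ) (X : Type*) (g : Γ) : Set (B × X × Set.Icc (0 : ℝ) T) :=
  {p | (p.2.2 : ℝ) + rnCocycle ν g p.1 ∈ Set.Icc 0 T}

theorem measurableSet_chartDomain [MeasurableSpace X] [Countable Γ] [MeasurableConstSMul Γ B]
    (ν : Measure B) (g : Γ) :
    MeasurableSet (chartDomain ν T X g) :=
  ((measurable_subtype_coe.comp (measurable_snd.comp measurable_snd)).add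
    ((measurable_rnCocycle ν g).comp measurable_fst)) measurableSet_Icc

variable [MulAction Γ X]

/-- The action of `g` on its domain in `B × X × [0,T]`. -/
noncomputable def chartMap (ν : Measure B) (hT : 0 ≤ T) (g : Γ)
    (p : B × X × Set.Icc (0 : ℝ) T) : B × X × Set.Icc (0 : ℝ) T :=
  (g • p.1, g • p.2.1, Set.projIcc 0 T hT (p.2.2 + rnCocycle ν g p.1))

theorem relIX_iff (ν : Measure B) (hT : 0 ≤ T) (p q : B × X × Set.Icc (0 : ℝ) T) :
    relIX Γ ν T p q ↔ ∃ g : Γ, p ∈ chartDomain ν T X g ∧ chartMap ν hT g p = q := by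
  refine exists_congr fun g => ?_
  obtain ⟨b, x, t⟩ := p
  obtain ⟨b', x', t'⟩ := q
  simp only [maharam, chartDomain, chartMap, Prod.mk.injEq, Set.mem_ofPred_eq]
  constructor
  · rintro ⟨⟨rfl, h⟩, rfl⟩
    have h1 : (t : ℝ) + rnCocycle ν g b ∈ Set.Icc 0 T := h ▸ t'.2
    exact ⟨h1, rfl, rfl, Subtype.ext
      ((congrArg Subtype.val (Set.projIcc_of_mem hT h1)).trans h)⟩
  · rintro ⟨h1, rfl, rfl, h⟩
    refine ⟨⟨rfl, ?_⟩, rfl⟩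
    rw [← h, Set.projIcc_of_mem hT h1]

theorem relIX_equivalence (ν : Measure B) : Equivalence (relIX Γ ν T (X := X)) := by
  refine ⟨fun p => ⟨1, ?_, one_smul _ _⟩, ?_, ?_⟩
  · simp [maharam, rnCocycle_one]
  · rintro ⟨b, x, t⟩ ⟨b', x', t'⟩ ⟨g, h, hx⟩
    simp only [maharam, Prod.mk.injEq] at h hx
    obtain ⟨rfl, h⟩ := h
    subst hx
    refine ⟨g⁻¹, ?_, inv_smul_smul g x⟩
    simp only [maharam, rnCocycle_inv_smul, inv_smul_smul, ← h, add_neg_cancel_right]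
  · rintro ⟨b, x, t⟩ ⟨b', x', t'⟩ ⟨b'', x'', t''⟩ ⟨g, h, hx⟩ ⟨g', h', hx'⟩
    simp only [maharam, Prod.mk.injEq] at h hx h' hx'
    obtain ⟨rfl, h⟩ := h
    obtain ⟨rfl, h'⟩ := h'
    subst hx
    subst hx'
    refine ⟨g' * g, ?_, mul_smul g' g x⟩
    simp only [maharam, rnCocycle_mul, mul_smul, Prod.mk.injEq, true_and]
    rw [← h', ← h]
    ring

theorem chartMap_inv_chartMap (ν : Measure B) (hT : 0 ≤ T) (g : Γ)
    {p : B × X × Set.Icc (0 : ℝ) T} (hp : p ∈ chartDomain ν T X g) :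
    chartMap ν hT g⁻¹ (chartMap ν hT g p) = p := by
  obtain ⟨b, x, t⟩ := p
  simp only [chartDomain, Set.mem_ofPred_eq] at hp
  simp only [chartMap, inv_smul_smul, rnCocycle_inv_smul, Set.projIcc_of_mem hT hp,
    add_neg_cancel_right, Set.projIcc_val]

variable [MeasurableSpace X] [Countable Γ] [MeasurableConstSMul Γ B] [MeasurableConstSMul Γ X]

theorem measurable_chartMap (ν : Measure B) (hT : 0 ≤ T) (g : Γ) :
    Measurable (chartMap (X := X) ν hT g) := by
  refine ((measurable_const_smul g).comp measurable_fst).prodMk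
    (((measurable_const_smul g).comp (measurable_fst.comp measurable_snd)).prodMk ?_)
  exact continuous_projIcc.measurable.comp
    ((measurable_subtype_coe.comp (measurable_snd.comp measurable_snd)).add
      ((measurable_rnCocycle ν g).comp measurable_fst))

/-- Partial transformations of `B × X × [0,T]` preserve the measure. -/
theorem lintegral_chartMap (ν : Measure B) [IsProbabilityMeasure ν]
    (hns : ∀ g : Γ, Measure.QuasiMeasurePreserving (fun b : B => g • b) ν ν) (hT : 0 < T)
    (μ : Measure X) [IsProbabilityMeasure μ] [SMulInvariantMeasure Γ X μ] (g : Γ)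
    {Ψ : B × X × Set.Icc (0 : ℝ) T → ℝ≥0∞} (hΨ : Measurable Ψ) :
    ∫⁻ p, (chartDomain ν T X g).indicator (fun p => Ψ (chartMap ν hT.le g p)) p
        ∂(ν.prod (μ.prod (thetaI T))) =
      ∫⁻ p, (chartDomain ν T X g⁻¹).indicator Ψ p ∂(ν.prod (μ.prod (thetaI T))) := by
  have := isProbabilityMeasure_thetaI hT
  have hm1 : Measurable ((chartDomain ν T X g).indicator fun p => Ψ (chartMap ν hT.le g p)) :=
    (hΨ.comp (measurable_chartMap ν hT.le g)).indicator (measurableSet_chartDomain ν g)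
  have hm2 : Measurable ((chartDomain ν T X g⁻¹).indicator Ψ) :=
    hΨ.indicator (measurableSet_chartDomain ν g⁻¹)
  rw [lintegral_prod _ hm1.aemeasurable, lintegral_prod _ hm2.aemeasurable]
  have hm3 : Measurable fun b => ∫⁻ z, (chartDomain ν T X g⁻¹).indicator Ψ (b, z)
      ∂(μ.prod (thetaI T)) := hm2.lintegral_prod_right'
  -- Substituting g b for b brings in the Jacobian e^(-c(g,b)); x ↦ g x preserves μ, and translation
  -- in t yields the same factor on the other side.
  rw [← lintegral_exp_neg_rnCocycle_mul ν hns g hm3]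
  refine lintegral_congr fun b => ?_
  rw [lintegral_prod (fun z => (chartDomain ν T X g).indicator
      (fun p => Ψ (chartMap ν hT.le g p)) (b, z)) (hm1.comp measurable_prodMk_left).aemeasurable,
    lintegral_prod (fun z => (chartDomain ν T X g⁻¹).indicator Ψ (g • b, z))
      (hm2.comp measurable_prodMk_left).aemeasurable]
  have hm4 : Measurable fun x => ∫⁻ t, (chartDomain ν T X g⁻¹).indicator Ψ (g • b, x, t)
      ∂(thetaI T) := (hm2.comp measurable_prodMk_left).lintegral_prod_right'
  rw [← (measurePreserving_smul g μ).lintegral_comp hm4,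
    ← lintegral_const_mul' _ _ ENNReal.ofReal_ne_top]
  refine lintegral_congr fun x => ?_
  have h1 := lintegral_thetaI_translate hT.le (rnCocycle ν g b)
    (h := fun t => Ψ (g • b, g • x, t))
    (hΨ.comp (measurable_prodMk_left.comp measurable_prodMk_left))
  refine Eq.trans (lintegral_congr fun t => ?_) (h1.trans ?_)
  · simp [Set.indicator, chartDomain, chartMap]
  · congr 1
    refine lintegral_congr fun t => ?_
    simp [Set.indicator, chartDomain, rnCocycle_inv_smul]

/-- The orbit relation of the skew product is a countable measure-preserving relation. -/
theorem orbitChart_relIX (ν : Measure B) [IsProbabilityMeasure ν]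
    (hns : ∀ g : Γ, Measure.QuasiMeasurePreserving (fun b : B => g • b) ν ν)
    (hfree : ∀ᵐ b ∂ν, ∀ g : Γ, g • b = b → g = 1) (hT : 0 < T)
    (μ : Measure X) [IsProbabilityMeasure μ] [SMulInvariantMeasure Γ X μ] :
    OrbitChart (ν.prod (μ.prod (thetaI T))) (relIX Γ ν T) (chartDomain ν T X)
      (chartMap (Γ := Γ) ν hT.le) where
  equivalence := relIX_equivalence ν
  measurableSet := measurableSet_chartDomain ν
  measurable := measurable_chartMap ν hT.le
  rel_iff := relIX_iff ν hT.le
  ae_injOn := by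
    have := isProbabilityMeasure_thetaI hT
    filter_upwards [Measure.quasiMeasurePreserving_fst.ae hfree] with p hp g _ g' _ h
    have h1 : g • p.1 = g' • p.1 := congrArg Prod.fst h
    have h2 := hp (g'⁻¹ * g) (by rw [mul_smul, h1, inv_smul_smul])
    exact (inv_mul_eq_one.1 h2).symm
  transport := by
    intro Φ hΦ
    have hm1 : ∀ g : Γ, Measurable ((chartDomain ν T X g).indicator
        fun p => Φ (p, chartMap ν hT.le g p)) := fun g =>
      (hΦ.comp (measurable_id.prodMk (measurable_chartMap ν hT.le g))).indicator
        (measurableSet_chartDomain ν g)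
    have hm2 : ∀ g : Γ, Measurable fun q => Φ (chartMap (X := X) ν hT.le g q, q) := fun g =>
      hΦ.comp ((measurable_chartMap ν hT.le g).prodMk measurable_id)
    rw [lintegral_tsum fun g => (hm1 g).aemeasurable, lintegral_tsum fun g =>
      ((hm2 g).indicator (measurableSet_chartDomain ν g)).aemeasurable,
      ← (Equiv.inv Γ).tsum_eq]
    -- After reindexing by inversion, mass sent along g⁻¹ is matched with mass received along g.
    refine tsum_congr fun g => ?_
    rw [Equiv.inv_apply, ← inv_inv g, inv_inv g⁻¹,
      ← lintegral_chartMap ν hns hT μ g⁻¹ (hm2 g⁻¹⁻¹)]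
    refine lintegral_congr fun p => ?_
    by_cases hp : p ∈ chartDomain ν T X g⁻¹
    · rw [Set.indicator_of_mem hp, Set.indicator_of_mem hp, chartMap_inv_chartMap ν hT.le _ hp]
    · rw [Set.indicator_of_notMem hp, Set.indicator_of_notMem hp]

end Chart

/-! ### Lifted families -/

section Lift

theorem BoundedOverlap.mono {O : Type*} {U : O → Set O} {ρ : O → ℝ} {C D : ℝ≥0∞}
    (h : BoundedOverlap U ρ C) (hCD : C ≤ D) : BoundedOverlap U ρ D := by
  intro g K hg p
  refine (h g K hg p).trans ?_
  gcongr

variable {Γ B X : Type*} [Group Γ] [MulAction Γ B] [MulAction Γ X] [MeasurableSpace B] {T : ℝ}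

/-- The projection `B × X × [0,T] → B × [0,T]`. -/
def dropMiddle (p : B × X × Set.Icc (0 : ℝ) T) : B × Set.Icc (0 : ℝ) T := (p.1, p.2.2)

/-- When the stabilizer of b is trivial, g b determines g and hence the coordinate g x. -/
theorem injOn_dropMiddle (ν : Measure B) {p : B × X × Set.Icc (0 : ℝ) T}
    (hp : ∀ g : Γ, g • p.1 = p.1 → g = 1) : Set.InjOn dropMiddle {q | relIX Γ ν T p q} := by
  rintro ⟨b, x, t⟩ ⟨g, hg, hx⟩ ⟨b', x', t'⟩ ⟨g', hg', hx'⟩ h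
  simp only [dropMiddle, Prod.mk.injEq, maharam] at h hg hx hg' hx'
  have h1 : g • p.1 = g' • p.1 := by rw [hg.1, hg'.1, h.1]
  have h2 : g'⁻¹ * g = 1 := hp _ (by rw [mul_smul, h1, inv_smul_smul])
  have h3 : g = g' := (inv_mul_eq_one.1 h2).symm
  rw [h3, hx'] at hx
  rw [h.1, h.2, hx]

theorem setCard_image {Y Z : Type*} {f : Y → Z} {S : Set Y} (h : S.InjOn f) :
    setCard (f '' S) = setCard S := by
  rw [setCard, setCard, h.encard_image]

theorem setCard_le_of_mapsTo {ν : Measure B} {p : B × X × Set.Icc (0 : ℝ) T}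
    (hp : ∀ g : Γ, g • p.1 = p.1 → g = 1) {S : Set (B × X × Set.Icc (0 : ℝ) T)}
    (hS : ∀ q ∈ S, relIX Γ ν T p q) {V : Set (B × Set.Icc (0 : ℝ) T)}
    (hSV : ∀ q ∈ S, dropMiddle q ∈ V) : setCard S ≤ setCard V := by
  rw [← setCard_image ((injOn_dropMiddle ν hp).mono hS)]
  refine setCard_mono ?_
  rintro _ ⟨q, hq, rfl⟩
  exact hSV q hq

variable {ν : Measure B} {𝕀 : Set ℝ}
  {F : 𝕀 → B × Set.Icc (0 : ℝ) T → Set (B × Set.Icc (0 : ℝ) T)}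

/-- A point g(b,t) of F_r(b,t) lifts through the same g, so the projection is onto; freeness makes
it injective. -/
theorem setCard_liftSubset (hF : IsBorelFamily (relI Γ ν T) F)
    {p : B × X × Set.Icc (0 : ℝ) T} (hp : ∀ g : Γ, g • p.1 = p.1 → g = 1) (r : 𝕀) :
    setCard (liftSubset Γ ν (F r) p) = setCard (F r (dropMiddle p)) := by
  rw [← setCard_image (S := liftSubset Γ ν (F r) p)
    ((injOn_dropMiddle ν hp).mono Set.inter_subset_right)]
  congr 1
  ext y
  constructor
  · rintro ⟨q, hq, rfl⟩
    exact hq.1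
  · intro hy
    obtain ⟨g, hg⟩ := hF.subset_class r _ hy
    exact ⟨(y.1, g • p.2.1, y.2), ⟨hy, g, hg, rfl⟩, rfl⟩

theorem finite_liftSubset (hF : IsBorelFamily (relI Γ ν T) F)
    {p : B × X × Set.Icc (0 : ℝ) T} (hp : ∀ g : Γ, g • p.1 = p.1 → g = 1) (r : 𝕀) :
    (liftSubset Γ ν (F r) p).Finite := by
  refine Set.Finite.of_finite_image ?_ ((injOn_dropMiddle ν hp).mono Set.inter_subset_right)
  refine (hF.finite r (dropMiddle p)).subset ?_
  rintro _ ⟨q, hq, rfl⟩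
  exact Set.mem_iUnion₂.2 ⟨r, le_rfl, hq.1⟩

/-- If the lifted set chosen at p', of index t ≤ r(p), meets the one at p, then p' projects into
F_t⁻¹F_{r(p)}. The union over all such t covers every choice of indices. -/
theorem boundedOverlap_of_isRegular (hF : IsBorelFamily (relI Γ ν T) F) {C : ℝ≥0∞}
    {G : Set (B × X × Set.Icc (0 : ℝ) T)}
    (hfree : ∀ p ∈ G, ∀ q, relIX Γ ν T p q → ∀ g : Γ, g • q.1 = q.1 → g = 1)
    (hreg : ∀ p ∈ G, ∀ r, setCard (⋃ t ≤ r, subsetMul (subsetInv (F t)) (F r) (dropMiddle p))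
      ≤ C * setCard (F r (dropMiddle p)))
    {E : Set (B × X × Set.Icc (0 : ℝ) T)} (hE : E ⊆ G) (r : B × X × Set.Icc (0 : ℝ) T → 𝕀) :
    BoundedOverlap (selectedFamily (fun s => liftSubset Γ ν (F s)) E r) (fun p => (r p : ℝ)) C := by
  have heq := relIX_equivalence (Γ := Γ) (X := X) (T := T) ν
  refine boundedOverlap_of_regular (fun p => ?_) fun p => ?_
  · by_cases hp : p ∈ E
    · exact (finite_liftSubset hF (hfree p (hE hp) p (heq.refl p)) (r p)).subset fun q hq => hq.2
    · exact Set.finite_empty.subset fun q hq => hp hq.1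
  · by_cases hp : p ∈ E
    · have hpf := hfree p (hE hp) p (heq.refl p)
      have h1 : selectedFamily (fun s => liftSubset Γ ν (F s)) E r p =
          liftSubset Γ ν (F (r p)) p := by
        ext q
        simp only [selectedFamily, Set.mem_ofPred_eq, hp, true_and]
      rw [h1, setCard_liftSubset hF hpf]
      refine (setCard_le_of_mapsTo (ν := ν) hpf ?_ ?_).trans (hreg p (hE hp) (r p))
      · rintro p' ⟨-, q, hq, hq'⟩
        exact heq.trans hq'.2 (heq.symm hq.2.2)
      · rintro p' ⟨hle, q, hq, hq'⟩
        refine Set.mem_iUnion₂.2 ⟨r p', hle, ?_⟩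
        exact Set.mem_iUnion₂.2 ⟨dropMiddle q, hq'.1, hq.2.1⟩
    · refine le_of_eq_of_le ?_ zero_le
      rw [setCard_eq_tsum, ENNReal.tsum_eq_zero]
      intro p'
      rw [Set.indicator_of_notMem]
      rintro ⟨-, q, -, hq⟩
      exact hp hq.1

theorem boundedOverlap_of_isTempered (hF : IsBorelFamily (relI Γ ν T) F) {C D : ℝ≥0∞}
    {G : Set (B × X × Set.Icc (0 : ℝ) T)} (a b : 𝕀 → ℝ≥0) (ha : ∀ r, 0 < a r)
    (hab : ∀ r, (b r : ℝ≥0∞) ≤ D * a r)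
    (hfree : ∀ p ∈ G, ∀ q, relIX Γ ν T p q → ∀ g : Γ, g • q.1 = q.1 → g = 1)
    (htemp : ∀ p ∈ G, ∀ r, setCard (⋃ t < r, subsetMul (subsetInv (F t)) (F r) (dropMiddle p))
      ≤ C * setCard (F r (dropMiddle p)))
    (hlow : ∀ p ∈ G, ∀ r, (a r : ℝ≥0∞) ≤ setCard (F r (dropMiddle p)))
    (hup : ∀ p ∈ G, ∀ q, relIX Γ ν T p q → ∀ r,
      setCard (subsetInv (F r) (dropMiddle q)) ≤ b r)
    {E : Set (B × X × Set.Icc (0 : ℝ) T)} (hE : E ⊆ G) (r : B × X × Set.Icc (0 : ℝ) T → 𝕀) :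
    BoundedOverlap (selectedFamily (fun s => liftSubset Γ ν (F s)) E r) (fun p => (r p : ℝ))
      (C + D) := by
  have heq := relIX_equivalence (Γ := Γ) (X := X) (T := T) ν
  have hsel : ∀ p ∈ E, selectedFamily (fun s => liftSubset Γ ν (F s)) E r p =
      liftSubset Γ ν (F (r p)) p := by
    intro p hp
    ext q
    simp only [selectedFamily, Set.mem_ofPred_eq, hp, true_and]
  have hcard : ∀ p ∈ E, setCard (selectedFamily (fun s => liftSubset Γ ν (F s)) E r p) =
      setCard (F (r p) (dropMiddle p)) := fun p hp => by
    rw [hsel p hp, setCard_liftSubset hF (hfree p (hE hp) p (heq.refl p))]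
  refine boundedOverlap_of_tempered (fun p => ?_) (fun p => ?_) fun p q => ?_
  · by_cases hp : p ∈ E
    · exact (finite_liftSubset hF (hfree p (hE hp) p (heq.refl p)) (r p)).subset fun q hq => hq.2
    · exact Set.finite_empty.subset fun q hq => hp hq.1
  · by_cases hp : p ∈ E
    · have hpf := hfree p (hE hp) p (heq.refl p)
      rw [hcard p hp, hsel p hp]
      refine (setCard_le_of_mapsTo (ν := ν) hpf ?_ ?_).trans (htemp p (hE hp) (r p))
      · rintro p' ⟨-, q, hq, hq'⟩
        exact heq.trans hq'.2 (heq.symm hq.2.2)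
      · rintro p' ⟨hlt, q, hq, hq'⟩
        refine Set.mem_iUnion₂.2 ⟨r p', hlt, ?_⟩
        exact Set.mem_iUnion₂.2 ⟨dropMiddle q, hq'.1, hq.2.1⟩
    · refine le_of_eq_of_le ?_ zero_le
      rw [setCard_eq_tsum, ENNReal.tsum_eq_zero]
      intro p'
      rw [Set.indicator_of_notMem]
      rintro ⟨-, q, -, hq⟩
      exact hp hq.1
  · set s := r p with hs
    have ha0 : (a s : ℝ≥0∞) ≠ 0 := by exact_mod_cast (ha s).ne'
    -- A witness p₀ places q in the class of a good point, where the bounds on F_s⁻¹(q) hold. Each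
    -- p' of rank s through q then weighs at most 1/a_s, and there are at most b_s ≤ D a_s of them.
    rcases Set.eq_empty_or_nonempty {p' | q ∈ selectedFamily (fun s => liftSubset Γ ν (F s)) E r p'
      ∧ (r p' : ℝ) = s} with h0 | ⟨p₀, hp₀, -⟩
    · rw [h0]
      simp
    · refine (tsum_indicator_mul_le_setCard _ _ (a s : ℝ≥0∞)⁻¹ ?_).trans ?_
      · rintro p' ⟨hq, hr⟩
        have hr' : r p' = s := Subtype.ext hr
        rw [hcard p' hq.1, hr']
        exact ENNReal.inv_le_inv.2 (hlow p' (hE hq.1) s)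
      · have hqp : relIX Γ ν T p₀ q := hp₀.2.2
        have hqf := hfree p₀ (hE hp₀.1) q hqp
        calc _ ≤ (a s : ℝ≥0∞)⁻¹ * (D * a s) := by
              gcongr
              refine le_trans ?_ ((hup p₀ (hE hp₀.1) q hqp s).trans (hab s))
              refine setCard_le_of_mapsTo (ν := ν) hqf ?_ ?_
              · rintro p' ⟨hq, -⟩
                exact heq.symm hq.2.2
              · rintro p' ⟨hq, hr⟩
                have hr' : r p' = s := Subtype.ext hr
                have := hq.2.1
                rw [hr'] at this
                exact this
          _ = D := by
              rw [mul_comm D, ← mul_assoc, ENNReal.inv_mul_cancel ha0 ENNReal.coe_ne_top, one_mul]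

variable [MeasurableSpace X]

theorem ae_dropMiddle (ν : Measure B) [IsProbabilityMeasure ν] (hT : 0 < T) (μ : Measure X)
    [IsProbabilityMeasure μ] {P : B × Set.Icc (0 : ℝ) T → Prop}
    (hP : ∀ᵐ y ∂(ν.prod (thetaI T)), P y) :
    ∀ᵐ p ∂(ν.prod (μ.prod (thetaI T))), P (dropMiddle p) := by
  have := isProbabilityMeasure_thetaI hT
  exact ((MeasurePreserving.id ν).prod
    (measurePreserving_snd (μ := μ) (ν := thetaI T))).quasiMeasurePreserving.ae hP

theorem classMeasurableSet_liftSubset (hF : IsBorelFamily (relI Γ ν T) F)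
    (m : Measure (B × X × Set.Icc (0 : ℝ) T)) :
    ClassMeasurableSet m (relIX Γ ν T) fun s => liftSubset Γ ν (F s) := by
  refine ⟨{z | (dropMiddle z.2.2) ∈ F z.1 (dropMiddle z.2.1)}, ?_, ae_of_all _ fun p q hq s => ?_⟩
  · have hd : Measurable (dropMiddle : B × X × Set.Icc (0 : ℝ) T → _) :=
      measurable_fst.prodMk (measurable_snd.comp measurable_snd)
    exact ((hd.comp (measurable_fst.comp measurable_snd)).prodMk
      ((hd.comp (measurable_snd.comp measurable_snd)).prodMk measurable_fst)) hF.measurable_graph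
  · exact ⟨fun h => h.1, fun h => ⟨h, hq⟩⟩

end Lift

/-- Lifted families satisfy maximal inequalities with a constant that does not depend on the
action on `X`. -/
theorem exists_isMaximalFamily_liftSubset {Γ : Type*} [Group Γ] [Countable Γ]
    {B : Type*} [MeasurableSpace B] [MulAction Γ B]
    [MeasurableConstSMul Γ B] (ν : Measure B) [IsProbabilityMeasure ν]
    (hns : ∀ g : Γ, Measure.QuasiMeasurePreserving (fun b : B => g • b) ν ν)
    (hfree : ∀ᵐ b ∂ν, ∀ g : Γ, g • b = b → g = 1) (T : ℝ) (hT : 0 < T) (𝕀 : Set ℝ)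
    (F : 𝕀 → B × Set.Icc (0 : ℝ) T → Set (B × Set.Icc (0 : ℝ) T))
    (hF : IsBorelFamily (relI Γ ν T) F)
    (hF' : IsRegularFamily (ν.prod (thetaI T)) F ∨
      (IsUniformFamily (ν.prod (thetaI T)) F ∧ IsTemperedFamily (ν.prod (thetaI T)) F)) :
    ∃ C : ℝ≥0, 1 ≤ C ∧ ∀ (X : Type*) [MeasurableSpace X] [MulAction Γ X]
      [MeasurableConstSMul Γ X] (μ : Measure X) [IsProbabilityMeasure μ]
      [SMulInvariantMeasure Γ X μ],
      IsMaximalFamily (ν.prod (μ.prod (thetaI T))) (relIX Γ ν T)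
        (fun s => liftSubset Γ ν (F s)) C := by
  have := isProbabilityMeasure_thetaI hT
  rcases hF' with ⟨C, -, hreg⟩ | ⟨⟨D, a, b, -, ha, -, hab, hFc, hFi⟩, h𝕀, C, -, htemp⟩
  · refine ⟨max 1 C, le_max_left _ _, fun X _ _ _ μ _ _ =>
      ⟨fun s p q hq => hq.2, classMeasurableSet_liftSubset hF _, ?_⟩⟩
    have hR := orbitChart_relIX ν hns hfree hT μ
    have h1 : ∀ᵐ p ∂(ν.prod (μ.prod (thetaI T))), ∀ g : Γ, g • p.1 = p.1 → g = 1 :=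
      Measure.quasiMeasurePreserving_fst.ae hfree
    refine ⟨_, (hR.ae_class h1).and (ae_dropMiddle ν hT μ hreg), fun p hp s =>
      finite_liftSubset hF (hp.1 p (hR.equivalence.refl p)) s, fun E hE r => ?_⟩
    refine (boundedOverlap_of_isRegular hF (fun p hp => hp.1) (fun p hp => hp.2) hE r).mono ?_
    exact_mod_cast le_max_right 1 C
  -- Uniformity holds off a null set depending on r; countability merges these into one.
  · have : Countable 𝕀 := by
      rw [h𝕀]
      refine Set.Countable.to_subtype ((Set.countable_range (fun n : ℕ => (n : ℝ))).mono ?_)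
      rintro _ ⟨n, -, rfl⟩
      exact ⟨n, rfl⟩
    refine ⟨max 1 (C + D), le_max_left _ _, fun X _ _ _ μ _ _ =>
      ⟨fun s p q hq => hq.2, classMeasurableSet_liftSubset hF _, ?_⟩⟩
    have hR := orbitChart_relIX ν hns hfree hT μ
    have h1 : ∀ᵐ p ∂(ν.prod (μ.prod (thetaI T))), ∀ g : Γ, g • p.1 = p.1 → g = 1 :=
      Measure.quasiMeasurePreserving_fst.ae hfree
    have h2 := ae_dropMiddle ν hT μ (ae_all_iff.2 hFc)
    have h3 := ae_dropMiddle ν hT μ (ae_all_iff.2 hFi)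
    have h4 := ae_dropMiddle ν hT μ htemp
    refine ⟨_, (hR.ae_class h1).and ((hR.ae_class h3).and (h2.and h4)), fun p hp s =>
      finite_liftSubset hF (hp.1 p (hR.equivalence.refl p)) s, fun E hE r => ?_⟩
    refine (boundedOverlap_of_isTempered (C := C) (D := D) hF a b ha
      (fun r => by exact_mod_cast hab r)
      (fun p hp => hp.1) (fun p hp => hp.2.2.2) (fun p hp r => (hp.2.2.1 r).1)
      (fun p hp q hq r => (hp.2.1 q hq r).2) hE r).mono ?_
    exact_mod_cast le_max_right 1 (C + D)

/-! ### Norms of averaged maximal functions -/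

section Norms

theorem lintegral_rpow_eq_eLpNorm_rpow {Y : Type*} [MeasurableSpace Y] {m : Measure Y}
    {f : Y → ℝ≥0∞} {p : ℝ≥0∞} (hp0 : p ≠ 0) (hp : p ≠ ∞) :
    ∫⁻ y, f y ^ p.toReal ∂m = eLpNorm f p m ^ p.toReal := by
  have h := ENNReal.toReal_pos hp0 hp
  rw [eLpNorm_eq_lintegral_rpow_enorm_toReal hp0 hp, ← ENNReal.rpow_mul, one_div,
    inv_mul_cancel₀ h.ne', ENNReal.rpow_one]
  simp

theorem eLpNorm_le_of_lintegral_rpow_le {Y Z : Type*} [MeasurableSpace Y] [MeasurableSpace Z]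
    {m : Measure Y} {κ : Measure Z} {E E' : Type*} [ENorm E] [ENorm E'] {f : Y → E}
    {g : Z → E'} {p : ℝ≥0∞} (hp0 : p ≠ 0) (hp : p ≠ ∞) {c : ℝ≥0∞}
    (h : ∫⁻ y, ‖f y‖ₑ ^ p.toReal ∂m ≤ c * ∫⁻ z, ‖g z‖ₑ ^ p.toReal ∂κ) :
    eLpNorm f p m ≤ c ^ (1 / p.toReal) * eLpNorm g p κ := by
  have h1 := ENNReal.toReal_pos hp0 hp
  rw [eLpNorm_eq_lintegral_rpow_enorm_toReal hp0 hp, eLpNorm_eq_lintegral_rpow_enorm_toReal hp0 hp,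
    ← ENNReal.mul_rpow_of_nonneg _ _ (by positivity)]
  gcongr

theorem eLpNorm_top_le {Y : Type*} [MeasurableSpace Y] {m : Measure Y} {f : Y → ℝ≥0∞} {c : ℝ≥0∞}
    (h : ∀ᵐ y ∂m, f y ≤ c) : eLpNorm f ∞ m ≤ c := by
  rw [eLpNorm_exponent_top]
  exact essSup_le_of_ae_le c h

theorem ae_le_eLpNorm_top {Y : Type*} [MeasurableSpace Y] {m : Measure Y} {E : Type*} [ENorm E]
    (f : Y → E) : ∀ᵐ y ∂m, ‖f y‖ₑ ≤ eLpNorm f ∞ m := by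
  rw [eLpNorm_exponent_top]
  exact ae_le_eLpNormEssSup

variable {B X : Type*} [MeasurableSpace B] [MeasurableSpace X] {T : ℝ}
  (ν : Measure B) (μ : Measure X) [IsProbabilityMeasure μ]

/-- Since e^t ≥ 1 on [0,T]. With the normalization 1/T this is the source of the factor (e^T - 1)/T.
-/
theorem lebI_le_thetaI (hT : 0 < T) :
    lebI T ≤ ENNReal.ofReal (Real.exp T - 1) • thetaI T := by
  have hT1 : 0 < Real.exp T - 1 := by
    have := Real.add_one_lt_exp hT.ne'
    linarith
  rw [thetaI, ← withDensity_smul _ (by fun_prop)]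
  conv_lhs => rw [← withDensity_one (μ := lebI T)]
  refine withDensity_mono (ae_of_all _ fun t => ?_)
  rw [Pi.smul_apply, smul_eq_mul, ← ENNReal.ofReal_mul hT1.le, Pi.one_apply,
    ENNReal.one_le_ofReal, mul_div_cancel₀ _ hT1.ne']
  exact Real.one_le_exp t.2.1

theorem lebI_univ : lebI T Set.univ = ENNReal.ofReal T := by
  rw [lebI, comap_subtype_coe_apply measurableSet_Icc, Set.image_univ, Subtype.range_coe,
    Real.volume_Icc, sub_zero]

theorem isProbabilityMeasure_smul_lebI (hT : 0 < T) :
    IsProbabilityMeasure (ENNReal.ofReal (1 / T) • lebI T) := by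
  refine ⟨?_⟩
  rw [Measure.smul_apply, lebI_univ, smul_eq_mul, ← ENNReal.ofReal_mul (by positivity),
    one_div, inv_mul_cancel₀ hT.ne', ENNReal.ofReal_one]

theorem ae_prod_ae_lebI (hT : 0 < T) {P : B × X × Set.Icc (0 : ℝ) T → Prop}
    (hP : ∀ᵐ p ∂(ν.prod (μ.prod (thetaI T))), P p) :
    ∀ᵐ z ∂(ν.prod μ), ∀ᵐ t ∂(lebI T), P (z.1, z.2, t) := by
  have := isProbabilityMeasure_thetaI hT
  have h1 := (measurePreserving_prodAssoc ν μ (thetaI T)).quasiMeasurePreserving.ae hP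
  filter_upwards [Measure.ae_ae_of_ae_prod h1] with z hz
  exact (Measure.absolutelyContinuous_of_le_smul (lebI_le_thetaI hT)).ae_le hz

variable {ν μ}

/-- Averages over `[0,T]` with respect to Lebesgue measure. -/
theorem eLpNorm_average_le (hT : 0 < T) {M : B × X × Set.Icc (0 : ℝ) T → ℝ≥0∞}
    (hM : AEMeasurable M (ν.prod (μ.prod (thetaI T)))) {p : ℝ≥0∞} (hp : 1 ≤ p) :
    eLpNorm (fun z : B × X => ENNReal.ofReal (1 / T) * ∫⁻ t, M (z.1, z.2, t) ∂(lebI T)) p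
      (ν.prod μ) ≤ ENNReal.ofReal (((Real.exp T - 1) / T) ^ (1 / p.toReal)) *
        eLpNorm M p (ν.prod (μ.prod (thetaI T))) := by
  have := isProbabilityMeasure_thetaI hT
  have hκ := isProbabilityMeasure_smul_lebI hT
  have hT1 : 0 < Real.exp T - 1 := by
    have := Real.add_one_lt_exp hT.ne'
    linarith
  rcases eq_or_ne p ∞ with rfl | htop
  · simp only [ENNReal.toReal_top, div_zero, Real.rpow_zero, ENNReal.ofReal_one, one_mul]
    refine eLpNorm_top_le ?_
    filter_upwards [ae_prod_ae_lebI ν μ hT (ae_le_eLpNorm_top M)] with z hz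
    calc _ ≤ ENNReal.ofReal (1 / T) * ∫⁻ t, eLpNorm M ∞ (ν.prod (μ.prod (thetaI T))) ∂(lebI T) := by
          refine mul_le_mul_right ?_ _
          exact lintegral_mono_ae hz
      _ = _ := by
          rw [lintegral_const, lebI_univ, mul_left_comm, ← ENNReal.ofReal_mul (by positivity),
            one_div, inv_mul_cancel₀ hT.ne', ENNReal.ofReal_one, mul_one]
  · have hp0 : p ≠ 0 := (zero_lt_one.trans_le hp).ne'
    have hr := ENNReal.toReal_pos hp0 htop
    rw [← ENNReal.ofReal_rpow_of_nonneg (by positivity) (by positivity)]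
    refine eLpNorm_le_of_lintegral_rpow_le hp0 htop ?_
    simp only [enorm_eq_self]
    have hM' := hM.measurable_mk
    have h1 : ∀ᵐ z ∂(ν.prod μ), (ENNReal.ofReal (1 / T) *
        ∫⁻ t, M (z.1, z.2, t) ∂(lebI T)) ^ p.toReal ≤
        ENNReal.ofReal ((Real.exp T - 1) / T) *
          ∫⁻ t, hM.mk M (z.1, z.2, t) ^ p.toReal ∂(thetaI T) := by
      filter_upwards [ae_prod_ae_lebI ν μ hT hM.ae_eq_mk] with z hz
      have hm : Measurable fun t : Set.Icc (0 : ℝ) T => hM.mk M (z.1, z.2, t) :=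
        hM'.comp (measurable_prodMk_left.comp measurable_prodMk_left)
      -- Jensen's inequality for the probability measure dt/T, as monotonicity of L^p norms.
      have h2 := eLpNorm_le_eLpNorm_of_exponent_le hp
        (μ := ENNReal.ofReal (1 / T) • lebI T) hm.aestronglyMeasurable
      rw [eLpNorm_one_eq_lintegral_enorm, lintegral_smul_measure] at h2
      simp only [enorm_eq_self, smul_eq_mul] at h2
      rw [lintegral_congr_ae hz]
      calc _ ≤ eLpNorm (fun t => hM.mk M (z.1, z.2, t)) p
            (ENNReal.ofReal (1 / T) • lebI T) ^ p.toReal := by gcongr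
        _ = ENNReal.ofReal (1 / T) * ∫⁻ t, hM.mk M (z.1, z.2, t) ^ p.toReal ∂(lebI T) := by
            rw [← lintegral_rpow_eq_eLpNorm_rpow hp0 htop, lintegral_smul_measure, smul_eq_mul]
        _ ≤ ENNReal.ofReal (1 / T) * (ENNReal.ofReal (Real.exp T - 1) *
              ∫⁻ t, hM.mk M (z.1, z.2, t) ^ p.toReal ∂(thetaI T)) := by
            refine mul_le_mul_right ?_ _
            rw [← smul_eq_mul, ← lintegral_smul_measure]
            exact lintegral_mono' (lebI_le_thetaI hT) le_rfl
        _ = _ := by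
            rw [← mul_assoc, ← ENNReal.ofReal_mul (by positivity), one_div, mul_comm T⁻¹,
              div_eq_mul_inv]
    refine (lintegral_mono_ae h1).trans ?_
    rw [lintegral_const_mul' _ _ ENNReal.ofReal_ne_top]
    refine mul_le_mul_right ?_ _
    refine le_of_eq ?_
    have hmr : Measurable fun q => hM.mk M q ^ p.toReal := hM'.pow_const _
    calc _ = ∫⁻ w, hM.mk M (MeasurableEquiv.prodAssoc w) ^ p.toReal
          ∂((ν.prod μ).prod (thetaI T)) :=
          (lintegral_prod (fun w : (B × X) × Set.Icc (0 : ℝ) T =>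
            hM.mk M (MeasurableEquiv.prodAssoc w) ^ p.toReal)
            (hmr.comp MeasurableEquiv.prodAssoc.measurable).aemeasurable).symm
      _ = ∫⁻ q, hM.mk M q ^ p.toReal ∂(ν.prod (μ.prod (thetaI T))) :=
          (measurePreserving_prodAssoc ν μ (thetaI T)).lintegral_comp hmr
      _ = _ := by
          refine lintegral_congr_ae ?_
          filter_upwards [hM.ae_eq_mk] with q hq
          rw [hq]

variable [IsProbabilityMeasure ν]

theorem ae_ae_swap {P : B × X → Prop} (hP : ∀ᵐ z ∂(ν.prod μ), P z) :
    ∀ᵐ x ∂μ, ∀ᵐ b ∂ν, P (b, x) := by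
  have h1 := (Measure.measurePreserving_swap (μ := μ) (ν := ν)).quasiMeasurePreserving.ae hP
  exact Measure.ae_ae_of_ae_prod h1

/-- Weighted averages over the first factor. -/
theorem eLpNorm_weighted_le {G : B × X → ℝ≥0∞} (hG : AEMeasurable G (ν.prod μ)) {ψ : B → ℝ}
    (hψ : AEMeasurable ψ ν) {p q : ℝ≥0∞} (hp : 1 ≤ p) (hpq : 1 / p + 1 / q = 1) :
    eLpNorm (fun x => ∫⁻ b, G (b, x) * ENNReal.ofReal (ψ b) ∂ν) p μ ≤
      eLpNorm ψ q ν * eLpNorm G p (ν.prod μ) := by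
  have hψe : ∀ b, ENNReal.ofReal (ψ b) ≤ ‖ψ b‖ₑ := fun b => Real.ofReal_le_enorm _
  have hG' := hG.measurable_mk
  have hGae := ae_ae_swap hG.ae_eq_mk
  have hswap : ∀ {h : B × X → ℝ≥0∞}, Measurable h →
      ∫⁻ x, ∫⁻ b, h (b, x) ∂ν ∂μ = ∫⁻ z, h z ∂(ν.prod μ) := fun {h} hh =>
    (lintegral_prod_symm h hh.aemeasurable).symm
  rcases eq_or_ne p ∞ with rfl | htop
  · have hq : q = 1 := by
      simpa [ENNReal.inv_eq_one] using hpq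
    subst hq
    refine eLpNorm_top_le ?_
    filter_upwards [ae_ae_swap (ν := ν) (μ := μ) (ae_le_eLpNorm_top G)] with x hx
    rw [eLpNorm_one_eq_lintegral_enorm, ← lintegral_mul_const'' _ hψ.enorm]
    refine lintegral_mono_ae ?_
    filter_upwards [hx] with b hb
    rw [mul_comm]
    exact mul_le_mul' (hψe b) hb
  rcases eq_or_ne p 1 with rfl | hp1
  · have hq : q = ∞ := by
      simpa using hpq
    subst hq
    rw [eLpNorm_one_eq_lintegral_enorm, eLpNorm_one_eq_lintegral_enorm]
    simp only [enorm_eq_self]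
    calc _ ≤ ∫⁻ x, eLpNorm ψ ∞ ν * ∫⁻ b, hG.mk G (b, x) ∂ν ∂μ := by
          refine lintegral_mono_ae ?_
          filter_upwards [hGae] with x hx
          have hGx : Measurable fun b => hG.mk G (b, x) := hG'.comp measurable_prodMk_right
          rw [← lintegral_const_mul _ hGx]
          refine lintegral_mono_ae ?_
          filter_upwards [hx, ae_le_eLpNorm_top ψ] with b hb hb'
          rw [hb, mul_comm]
          gcongr
          exact (hψe b).trans hb'
      _ = _ := by
          rw [lintegral_const_mul _ (hG'.lintegral_prod_left'), hswap hG',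
            lintegral_congr_ae hG.ae_eq_mk]
  · have hp1' : 1 < p := lt_of_le_of_ne hp hp1.symm
    have hp0 : p ≠ 0 := (zero_lt_one.trans_le hp).ne'
    have hq0 : q ≠ 0 := by
      rintro rfl
      simp at hpq
    have hqtop : q ≠ ∞ := by
      rintro rfl
      simp [ENNReal.inv_eq_one] at hpq
      exact hp1 hpq
    have hr := ENNReal.toReal_pos hp0 htop
    have hs := ENNReal.toReal_pos hq0 hqtop
    have hconj : p.toReal.HolderConjugate q.toReal := by
      rw [Real.holderConjugate_iff]
      refine ⟨by simpa using (ENNReal.toReal_lt_toReal ENNReal.one_ne_top htop).2 hp1', ?_⟩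
      have h := congrArg ENNReal.toReal hpq
      rw [ENNReal.toReal_add (by simpa using hp0) (by simpa using hq0)] at h
      simpa using h
    have h0 := eLpNorm_le_of_lintegral_rpow_le (m := μ) (κ := ν.prod μ)
      (f := fun x => ∫⁻ b, G (b, x) * ENNReal.ofReal (ψ b) ∂ν) (g := G)
      (c := eLpNorm ψ q ν ^ p.toReal) hp0 htop ?_
    · refine h0.trans_eq ?_
      rw [← ENNReal.rpow_mul, mul_one_div_cancel hr.ne', ENNReal.rpow_one]
    · simp only [enorm_eq_self]
      calc _ ≤ ∫⁻ x, eLpNorm ψ q ν ^ p.toReal * ∫⁻ b, hG.mk G (b, x) ^ p.toReal ∂ν ∂μ := by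
            refine lintegral_mono_ae ?_
            filter_upwards [hGae] with x hx
            have hGx : Measurable fun b => hG.mk G (b, x) := hG'.comp measurable_prodMk_right
            -- Hölder in b at fixed x; the factor from ψ does not depend on x.
            have h1 := ENNReal.lintegral_mul_le_Lp_mul_Lq ν hconj hGx.aemeasurable
              hψ.ennreal_ofReal
            have h2 : ∫⁻ b, G (b, x) * ENNReal.ofReal (ψ b) ∂ν ≤
                (∫⁻ b, hG.mk G (b, x) ^ p.toReal ∂ν) ^ (1 / p.toReal) * eLpNorm ψ q ν := by
              refine le_trans (le_of_eq (lintegral_congr_ae ?_)) (h1.trans ?_)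
              · filter_upwards [hx] with b hb
                simp [hb]
              · rw [eLpNorm_eq_lintegral_rpow_enorm_toReal hq0 hqtop]
                gcongr
                exact hψe _
            calc _ ≤ ((∫⁻ b, hG.mk G (b, x) ^ p.toReal ∂ν) ^ (1 / p.toReal) *
                  eLpNorm ψ q ν) ^ p.toReal := by gcongr
              _ = _ := by
                  rw [ENNReal.mul_rpow_of_nonneg _ _ hr.le, ← ENNReal.rpow_mul, one_div,
                    inv_mul_cancel₀ hr.ne', ENNReal.rpow_one, mul_comm]
        _ = _ := by
            have hmr : Measurable fun z => hG.mk G z ^ p.toReal := hG'.pow_const _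
            rw [lintegral_const_mul _ hmr.lintegral_prod_left', hswap hmr]
            congr 1
            refine lintegral_congr_ae ?_
            filter_upwards [hG.ae_eq_mk] with z hz
            rw [hz]

end Norms

/-! ### The maximal functions of the lifted family -/

section Operators

variable {Γ B X : Type*} [Group Γ] [MulAction Γ B] [MulAction Γ X] [MeasurableSpace B]
  {T : ℝ} {𝕀 : Set ℝ} {ν : Measure B}
  {F : 𝕀 → B × Set.Icc (0 : ℝ) T → Set (B × Set.Icc (0 : ℝ) T)}

theorem maxOpBar_le (f : B × X × Set.Icc (0 : ℝ) T → ℝ) (z : B × X) :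
    maxOpBar Γ ν F f z ≤
      ENNReal.ofReal (1 / T) * ∫⁻ t, maxOp Γ ν F f (z.1, z.2, t) ∂(lebI T) := by
  refine iSup_le fun r => mul_le_mul_right (lintegral_mono fun t => ?_) _
  exact le_iSup (fun r : 𝕀 => subsetAverage (fun q => ‖f q‖ₑ) (liftSubset Γ ν (F r))
    (z.1, z.2, t)) r

theorem maxOpWeighted_le (f : B × X × Set.Icc (0 : ℝ) T → ℝ) (ψ : B → ℝ) (x : X) :
    maxOpWeighted Γ ν F f ψ x ≤ ∫⁻ b, maxOpBar Γ ν F f (b, x) * ENNReal.ofReal (ψ b) ∂ν := by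
  refine iSup_le fun r => ?_
  rw [← lintegral_const_mul' _ _ ENNReal.ofReal_ne_top]
  refine lintegral_mono fun b => ?_
  dsimp only
  rw [lintegral_mul_const' _ _ ENNReal.ofReal_ne_top, ← mul_assoc]
  gcongr
  exact le_iSup (fun r : 𝕀 => ENNReal.ofReal (1 / T) * ∫⁻ t, subsetAverage (fun q => ‖f q‖ₑ)
    (liftSubset Γ ν (F r)) (b, x, t) ∂(lebI T)) r

variable [MeasurableSpace X] {μ : Measure X} [StandardBorelSpace X] [StandardBorelSpace 𝕀]
  [IsProbabilityMeasure ν] [IsProbabilityMeasure μ] {ι : Type*} [Countable ι]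
  {A : ι → Set (B × X × Set.Icc (0 : ℝ) T)}
  {φ : ι → B × X × Set.Icc (0 : ℝ) T → B × X × Set.Icc (0 : ℝ) T}

/-- The averages have a jointly Borel version off one null set common to all r. Its integrals are
Borel in (x, r) by Tonelli, and the supremum over r is then measurable up to a null set. -/
theorem aemeasurable_maxOpWeighted (hT : 0 < T) {C : ℝ≥0∞}
    (hF : IsMaximalFamily (ν.prod (μ.prod (thetaI T))) (relIX Γ ν T)
      (fun s => liftSubset Γ ν (F s)) C)
    (hR : OrbitChart (ν.prod (μ.prod (thetaI T))) (relIX Γ ν T) A φ)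
    {f : B × X × Set.Icc (0 : ℝ) T → ℝ} (hf : AEMeasurable f (ν.prod (μ.prod (thetaI T))))
    {ψ : B → ℝ} (hψ : AEMeasurable ψ ν) :
    AEMeasurable (maxOpWeighted Γ ν F f ψ) μ := by
  obtain ⟨H, hH, hHF⟩ := hR.exists_measurable_subsetAverage hF.rel hF.classMeasurableSet hf.enorm
  have hψ' := hψ.measurable_mk
  have hm : Measurable fun w : X × 𝕀 => ENNReal.ofReal (1 / T) *
      ∫⁻ b, ∫⁻ t, H (w.2, b, w.1, t) * ENNReal.ofReal (hψ.mk ψ b) ∂(lebI T) ∂ν := by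
    refine Measurable.const_mul (Measurable.lintegral_prod_right'
      (f := fun v : (X × 𝕀) × B => ∫⁻ t, H (v.1.2, v.2, v.1.1, t) *
        ENNReal.ofReal (hψ.mk ψ v.2) ∂(lebI T)) (Measurable.lintegral_prod_right'
      (f := fun u : ((X × 𝕀) × B) × Set.Icc (0 : ℝ) T => H (u.1.1.2, u.1.2, u.1.1.1, u.2) *
        ENNReal.ofReal (hψ.mk ψ u.1.2)) (Measurable.mul (hH.comp ?_)
          (hψ'.comp ?_).ennreal_ofReal))) _
    · fun_prop
    · fun_prop
  refine (aemeasurable_iSup_prod μ hm).congr ?_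
  filter_upwards [ae_ae_swap (ae_prod_ae_lebI ν μ hT hHF)] with x hx
  rw [maxOpWeighted]
  refine iSup_congr fun r => ?_
  congr 1
  refine lintegral_congr_ae ?_
  filter_upwards [hx, hψ.ae_eq_mk] with b hb hbψ
  refine lintegral_congr_ae ?_
  filter_upwards [hb] with t ht
  rw [ht r, hbψ]

variable [StandardBorelSpace B]

theorem aemeasurable_maxOpBar (hT : 0 < T) {C : ℝ≥0∞}
    (hF : IsMaximalFamily (ν.prod (μ.prod (thetaI T))) (relIX Γ ν T)
      (fun s => liftSubset Γ ν (F s)) C)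
    (hR : OrbitChart (ν.prod (μ.prod (thetaI T))) (relIX Γ ν T) A φ)
    {f : B × X × Set.Icc (0 : ℝ) T → ℝ} (hf : AEMeasurable f (ν.prod (μ.prod (thetaI T)))) :
    AEMeasurable (maxOpBar Γ ν F f) (ν.prod μ) := by
  obtain ⟨H, hH, hHF⟩ := hR.exists_measurable_subsetAverage hF.rel hF.classMeasurableSet hf.enorm
  have hm : Measurable fun w : (B × X) × 𝕀 =>
      ENNReal.ofReal (1 / T) * ∫⁻ t, H (w.2, w.1.1, w.1.2, t) ∂(lebI T) := by
    refine Measurable.const_mul (Measurable.lintegral_prod_right'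
      (f := fun v : ((B × X) × 𝕀) × Set.Icc (0 : ℝ) T => H (v.1.2, v.1.1.1, v.1.1.2, v.2))
      (hH.comp ?_)) _
    fun_prop
  refine (aemeasurable_iSup_prod (ν.prod μ) hm).congr ?_
  filter_upwards [ae_prod_ae_lebI ν μ hT hHF] with z hz
  rw [maxOpBar]
  refine iSup_congr fun r => ?_
  congr 1
  refine lintegral_congr_ae ?_
  filter_upwards [hz] with t ht
  exact (ht r).symm

/-- The constants in the maximal inequalities. -/
noncomputable def maximalConst (C : ℝ≥0) (p : ℝ≥0∞) : ℝ≥0 :=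
  1 + 12 * C + (strongConst C p.toReal ^ (1 / p.toReal)).toNNReal

theorem eLpNorm_maxOp_le [Nonempty 𝕀] (hT : 0 < T) {C : ℝ≥0} (hC : 1 ≤ C)
    (hF : IsMaximalFamily (ν.prod (μ.prod (thetaI T))) (relIX Γ ν T)
      (fun s => liftSubset Γ ν (F s)) C)
    (hR : OrbitChart (ν.prod (μ.prod (thetaI T))) (relIX Γ ν T) A φ)
    {f : B × X × Set.Icc (0 : ℝ) T → ℝ} (hf : AEMeasurable f (ν.prod (μ.prod (thetaI T))))
    {p : ℝ≥0∞} (hp : 1 < p) :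
    eLpNorm (maxOp Γ ν F f) p (ν.prod (μ.prod (thetaI T))) ≤
      maximalConst C p * eLpNorm f p (ν.prod (μ.prod (thetaI T))) := by
  have := isProbabilityMeasure_thetaI hT
  have : StandardBorelSpace (Set.Icc (0 : ℝ) T) := measurableSet_Icc.standardBorel
  rcases eq_or_ne p ∞ with rfl | htop
  · refine (eLpNorm_top_le (hF.ae_iSup_le hR (ae_le_eLpNorm_top f))).trans ?_
    refine le_mul_of_one_le_left zero_le ?_
    -- The summand 1 of the constant serves p = ∞; the summand 12 C serves p = 1 and the last one
    -- finite p > 1.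
    have : (1 : ℝ≥0) ≤ maximalConst C ∞ := by
      rw [maximalConst, add_assoc]
      exact le_self_add
    exact_mod_cast this
  · have hp0 : p ≠ 0 := (zero_lt_one.trans hp).ne'
    have hp1 : 1 < p.toReal := by
      simpa using (ENNReal.toReal_lt_toReal ENNReal.one_ne_top htop).2 hp
    refine (eLpNorm_le_of_lintegral_rpow_le hp0 htop (c := strongConst C p.toReal)
      (hF.lintegral_rpow_le hR hC hf hp1)).trans ?_
    gcongr
    have hfin : strongConst C p.toReal ^ (1 / p.toReal) ≠ ∞ :=
      ENNReal.rpow_ne_top_of_nonneg (by positivity) (strongConst_ne_top C hp1)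
    rw [← ENNReal.coe_toNNReal hfin]
    have : (strongConst C p.toReal ^ (1 / p.toReal)).toNNReal ≤ maximalConst C p := by
      rw [maximalConst]
      exact le_add_self
    exact_mod_cast this

theorem eLpNorm_one_maxOp_le [Nonempty 𝕀] (hT : 0 < T) {C : ℝ≥0} (hC : 1 ≤ C)
    (hF : IsMaximalFamily (ν.prod (μ.prod (thetaI T))) (relIX Γ ν T)
      (fun s => liftSubset Γ ν (F s)) C)
    (hR : OrbitChart (ν.prod (μ.prod (thetaI T))) (relIX Γ ν T) A φ)
    {f : B × X × Set.Icc (0 : ℝ) T → ℝ} (hf : AEMeasurable f (ν.prod (μ.prod (thetaI T)))) :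
    eLpNorm (maxOp Γ ν F f) 1 (ν.prod (μ.prod (thetaI T))) ≤
      maximalConst C 1 * lLogLNorm f (ν.prod (μ.prod (thetaI T))) := by
  have := isProbabilityMeasure_thetaI hT
  have : StandardBorelSpace (Set.Icc (0 : ℝ) T) := measurableSet_Icc.standardBorel
  have h1 : (12 * C : ℝ≥0) ≤ maximalConst C 1 := by
    rw [maximalConst]
    exact le_add_self.trans le_self_add
  have h0 : (maximalConst C 1 : ℝ≥0∞) ≠ 0 := by
    have : maximalConst C 1 ≠ 0 :=
      ((mul_pos (by norm_num) (zero_lt_one.trans_le hC)).trans_le h1).ne'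
    exact_mod_cast this
  -- Dividing by the constant isolates the infimum in the Luxemburg norm, so each admissible k can
  -- be treated separately.
  rw [mul_comm, ← ENNReal.div_le_iff_le_mul (Or.inl h0) (Or.inl ENNReal.coe_ne_top)]
  refine le_iInf fun k => le_iInf fun hk => le_iInf fun h => ENNReal.div_le_of_le_mul' ?_
  rw [eLpNorm_one_eq_lintegral_enorm]
  refine (hF.lintegral_le_of_posLog hR hC hf hk h).trans ?_
  gcongr
  exact_mod_cast h1

end Operators

end MaximalErgodic

/-! ### Norm bounds for the three maximal functions -/

theorem mainTheorem7 {Γ : Type*} [Group Γ] [Countable Γ]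
    {B : Type*} [MeasurableSpace B] [StandardBorelSpace B] [MulAction Γ B]
    [MeasurableConstSMul Γ B] (ν : Measure B) [IsProbabilityMeasure ν]
    (hns : ∀ g : Γ, Measure.QuasiMeasurePreserving (fun b : B => g • b) ν ν)
    (hfree : ∀ᵐ b ∂ν, ∀ g : Γ, g • b = b → g = 1)
    (T : ℝ) (hT : 0 < T)
    (𝕀 : Set ℝ) (h𝕀 : 𝕀 = posInt ∨ 𝕀 = Set.Ioi 0)
    (F : 𝕀 → B × Set.Icc (0 : ℝ) T → Set (B × Set.Icc (0 : ℝ) T))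
    (hF : IsBorelFamily (relI Γ ν T) F)
    (hF' : IsRegularFamily (ν.prod (thetaI T)) F ∨
      (IsAsymptoticallyInvariant (relI Γ ν T) (ν.prod (thetaI T)) F ∧
        IsUniformFamily (ν.prod (thetaI T)) F ∧ IsTemperedFamily (ν.prod (thetaI T)) F)) :
    ∃ C : ℝ≥0∞ → ℝ≥0, (∀ p, 0 < C p) ∧
      ∀ (X : Type*) [MeasurableSpace X] [StandardBorelSpace X] [MulAction Γ X]
        [MeasurableConstSMul Γ X] (μ : Measure X) [IsProbabilityMeasure μ]
        [SMulInvariantMeasure Γ X μ],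
        -- the maximal functions are measurable, up to null sets
        (∀ f : B × X × Set.Icc (0 : ℝ) T → ℝ, Integrable f (ν.prod (μ.prod (thetaI T))) →
          AEMeasurable (maxOp Γ ν F f) (ν.prod (μ.prod (thetaI T))) ∧
          AEMeasurable (maxOpBar Γ ν F f) (ν.prod μ) ∧
          ∀ ψ : B → ℝ, Integrable ψ ν → 0 ≤ᵐ[ν] ψ →
            AEMeasurable (maxOpWeighted Γ ν F f ψ) μ) ∧
        -- the bounds in `L^p`
        (∀ p : ℝ≥0∞, 1 < p → ∀ f : B × X × Set.Icc (0 : ℝ) T → ℝ,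
          MemLp f p (ν.prod (μ.prod (thetaI T))) →
          eLpNorm (maxOp Γ ν F f) p (ν.prod (μ.prod (thetaI T)))
            ≤ C p * eLpNorm f p (ν.prod (μ.prod (thetaI T))) ∧
          eLpNorm (maxOpBar Γ ν F f) p (ν.prod μ)
            ≤ C p * ENNReal.ofReal (((Real.exp T - 1) / T) ^ (1 / p.toReal)) *
              eLpNorm f p (ν.prod (μ.prod (thetaI T))) ∧
          ∀ q : ℝ≥0∞, 1 / p + 1 / q = 1 → ∀ ψ : B → ℝ, MemLp ψ q ν → 0 ≤ᵐ[ν] ψ →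
            eLpNorm (maxOpWeighted Γ ν F f ψ) p μ
              ≤ C p * ENNReal.ofReal (((Real.exp T - 1) / T) ^ (1 / p.toReal)) *
                eLpNorm ψ q ν * eLpNorm f p (ν.prod (μ.prod (thetaI T)))) ∧
        -- the bounds from `L log L` to `L^1`
        (∀ f : B × X × Set.Icc (0 : ℝ) T → ℝ,
          MemLLogL f (ν.prod (μ.prod (thetaI T))) →
          eLpNorm (maxOp Γ ν F f) 1 (ν.prod (μ.prod (thetaI T)))
            ≤ C 1 * lLogLNorm f (ν.prod (μ.prod (thetaI T))) ∧
          eLpNorm (maxOpBar Γ ν F f) 1 (ν.prod μ)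
            ≤ C 1 * ENNReal.ofReal ((Real.exp T - 1) / T) *
              lLogLNorm f (ν.prod (μ.prod (thetaI T))) ∧
          ∀ ψ : B → ℝ, MemLp ψ ∞ ν → 0 ≤ᵐ[ν] ψ →
            eLpNorm (maxOpWeighted Γ ν F f ψ) 1 μ
              ≤ C 1 * ENNReal.ofReal ((Real.exp T - 1) / T) *
                eLpNorm ψ ∞ ν * lLogLNorm f (ν.prod (μ.prod (thetaI T)))) := by
  have hreg : IsRegularFamily (ν.prod (thetaI T)) F ∨
      (IsUniformFamily (ν.prod (thetaI T)) F ∧ IsTemperedFamily (ν.prod (thetaI T)) F) :=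
    hF'.imp id fun h => h.2
  obtain ⟨C, hC, hmax⟩ := exists_isMaximalFamily_liftSubset ν hns hfree T hT 𝕀 F hF hreg
  have h𝕀m : MeasurableSet 𝕀 := by
    rcases h𝕀 with rfl | rfl
    · refine ((Set.countable_range (fun n : ℕ => (n : ℝ))).mono ?_).measurableSet
      rintro _ ⟨n, -, rfl⟩
      exact ⟨n, rfl⟩
    · exact measurableSet_Ioi
  have : StandardBorelSpace 𝕀 := h𝕀m.standardBorel
  have : Nonempty 𝕀 := by
    rcases h𝕀 with rfl | rfl
    · exact ⟨⟨1, 1, one_pos, by norm_num⟩⟩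
    · exact ⟨⟨1, Set.mem_Ioi.mpr one_pos⟩⟩
  have := isProbabilityMeasure_thetaI hT
  have : StandardBorelSpace (Set.Icc (0 : ℝ) T) := measurableSet_Icc.standardBorel
  refine ⟨maximalConst C, fun p => ?_, ?_⟩
  · rw [maximalConst, add_assoc]
    exact zero_lt_one.trans_le le_self_add
  intro X _ _ _ _ μ _ _
  have hR := orbitChart_relIX (X := X) ν hns hfree hT μ
  have hFX := hmax X μ
  -- Only the pointwise maximal function needs ergodic input. The t-averaged one is dominated by its
  -- average and the weighted one by the ψ-integral of the latter, which gives the factors (e^T -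
  -- 1)/T and ‖ψ‖_q.
  have hbar : ∀ {f : B × X × Set.Icc (0 : ℝ) T → ℝ},
      AEMeasurable f (ν.prod (μ.prod (thetaI T))) → ∀ {p : ℝ≥0∞}, 1 ≤ p →
      eLpNorm (maxOpBar Γ ν F f) p (ν.prod μ) ≤
        ENNReal.ofReal (((Real.exp T - 1) / T) ^ (1 / p.toReal)) *
          eLpNorm (maxOp Γ ν F f) p (ν.prod (μ.prod (thetaI T))) := fun {f} hf {p} hp =>
    (eLpNorm_mono_enorm fun z => maxOpBar_le f z).trans
      (eLpNorm_average_le hT (hFX.aemeasurable_iSup hR hf.enorm) hp)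
  have hwei : ∀ {f : B × X × Set.Icc (0 : ℝ) T → ℝ},
      AEMeasurable f (ν.prod (μ.prod (thetaI T))) → ∀ {ψ : B → ℝ}, AEMeasurable ψ ν →
      ∀ {p q : ℝ≥0∞}, 1 ≤ p → 1 / p + 1 / q = 1 →
      eLpNorm (maxOpWeighted Γ ν F f ψ) p μ ≤
        eLpNorm ψ q ν * eLpNorm (maxOpBar Γ ν F f) p (ν.prod μ) :=
    fun {f} hf {ψ} hψ {p q} hp hpq =>
    (eLpNorm_mono_enorm fun x => maxOpWeighted_le f ψ x).trans
      (eLpNorm_weighted_le (aemeasurable_maxOpBar hT hFX hR hf) hψ hp hpq)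
  refine ⟨fun f hf => ?_, fun p hp f hf => ?_, fun f hf => ?_⟩
  · have hfm := hf.aestronglyMeasurable.aemeasurable
    exact ⟨hFX.aemeasurable_iSup hR hfm.enorm, aemeasurable_maxOpBar hT hFX hR hfm,
      fun ψ hψ _ => aemeasurable_maxOpWeighted hT hFX hR hfm hψ.aestronglyMeasurable.aemeasurable⟩
  · have hfm := hf.aestronglyMeasurable.aemeasurable
    have h1 := eLpNorm_maxOp_le hT hC hFX hR hfm hp
    have h2 : eLpNorm (maxOpBar Γ ν F f) p (ν.prod μ) ≤ maximalConst C p *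
        ENNReal.ofReal (((Real.exp T - 1) / T) ^ (1 / p.toReal)) *
          eLpNorm f p (ν.prod (μ.prod (thetaI T))) := by
      refine (hbar hfm hp.le).trans ((mul_le_mul_right h1 _).trans_eq ?_)
      ring
    refine ⟨h1, h2, fun q hpq ψ hψ _ => ?_⟩
    refine (hwei hfm hψ.aestronglyMeasurable.aemeasurable hp.le hpq).trans
      ((mul_le_mul_right h2 _).trans_eq ?_)
    ring
  · have hfm := hf.1.aemeasurable
    have h1 := eLpNorm_one_maxOp_le hT hC hFX hR hfm
    have h2 : eLpNorm (maxOpBar Γ ν F f) 1 (ν.prod μ) ≤ maximalConst C 1 *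
        ENNReal.ofReal ((Real.exp T - 1) / T) * lLogLNorm f (ν.prod (μ.prod (thetaI T))) := by
      have h3 := hbar hfm (le_refl (1 : ℝ≥0∞))
      rw [ENNReal.toReal_one, div_one, Real.rpow_one] at h3
      refine h3.trans ((mul_le_mul_right h1 _).trans_eq ?_)
      ring
    refine ⟨h1, h2, fun ψ hψ _ => ?_⟩
    refine (hwei (q := ∞) hfm hψ.aestronglyMeasurable.aemeasurable le_rfl (by simp)).trans
      ((mul_le_mul_right h2 _).trans_eq ?_)
    ring
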